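/- **Setting.** A system $(X,\mathcal F,\mu,T)$ is a probability space with a measurable, measure-preserving map $T:X\to X$; it is invertible if $T$ is a bijection with measurable inverse. Functions are complex valued and $\mathbb N=\{1,2,\dots\}$. For $f\in L^\infty(\mu)$ and $N\in\mathbb N$ the higher-order Wiener–Wintner (WW) averages are $$W_N^1(f)=\Big\|\sup_{t\in\mathbb R}\Big|\frac1N\sum_{n=1}^N e^{2\pi i n t}f\circ T^n\Big|\Big\|_{L^2(\mu)}^{2/3},\qquad W_N^{k}(f)=\frac1{\lfloor\sqrt N\rfloor}\sum_{h=1}^{\lfloor\sqrt N\rfloor}W_N^{k-1}\big(f\cdot\overline{f\circ T^h}\big)\quad(k\ge2).$$ For $\alpha>0$ let $\mathrm{Poly}(\mathbb N,\alpha)$ be the set of $r:\mathbb N\to\mathbb R$ with $r(N)=O(N^{-\alpha})$, and let $\mathrm{Poly}(\mathbb N)=\bigcup_{\alpha>0}\mathrm{Poly}(\mathbb N,\alpha)$. A function $f\in L^\infty(\mu)$ is a $k$-th order WW function of power type $\alpha$ if $W^k_N(f)\in\mathrm{Poly}(\mathbb N,\alpha)$, and of power type if $W^k_N(f)\in\mathrm{Poly}(\mathbb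 N)$. For $a,b:\mathbb N\to[0,\infty)$ write $a\precsim b$ if there are $0<\alpha,\beta,\gamma\le1$, $C>0$, $N_0\in\mathbb N$ and a nondecreasing $\phi:\mathbb N\to\mathbb N$ with $\phi(N)\ge N^\beta$ such that $a(N)\le C\big(N^{-\alpha}+b(\phi(N))^\gamma\big)$ for all $N>N_0$; write $a\precsim_k b$ if these parameters depend on $k$ only, and $a\approx b$ if $a\precsim b$ and $b\precsim a$. **Theorem.** Let $k\in\mathbb N$. There are $N_k$ and $C''_k$, depending only on $k$, such that for all invertible systems $(X,\mathcal F,\mu,T)$ and all $f_1,f_2\in L^\infty(\mu)$ with $\|f_1\|_\infty,\|f_2\|_\infty\le1$, $$W_N^k(f_1+f_2)\le C''_k\Big(\frac1{N^{1/(3\cdot2^{k+3})}}+\big[W^k_{\lfloor N^{1/4}\rfloor}(f_1)\big]^{1/(3\cdot2^k)}+\big[W^k_{\lfloor N^{1/4}\rfloor}(f_2)\big]^{1/(3\cdot2^k)}\Big)\qquad\text{for all }N\ge N_k .$$ Hence, for all such systems and functions, $W_N^k(f_1+f_2)\precsim_k W_N^k(f_1)+W_N^k(f_2)$. **Corollary.**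 Let $k\in\mathbb N$ and let $(X,\mathcal F,\mu,T)$ be an invertible system. If $f_1,f_2\in L^\infty(\mu)$ are $k$-th order WW functions of power type, then so is $f_1+f_2$, and $$\{f\in L^\infty(\mu):W_N^k(f)\in\mathrm{Poly}(\mathbb N)\}=\{f\in L^\infty(\mu):W_N^k(f)\approx0\}$$ is a (complex) vector space. Moreover, for $\alpha,\beta>0$ and $f_1,f_2\in L^\infty(\mu)$, if $W_N^k(f_1)\in\mathrm{Poly}(\mathbb N,\alpha)$ and $W_N^k(f_2)\in\mathrm{Poly}(\mathbb N,\beta)$, then $W_N^k(f_1+f_2)\in\mathrm{Poly}\big(\mathbb N,\tfrac{\min\{\alpha,\beta\}}{3\cdot2^{k+2}}\big)$. -/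

import Mathlib

open MeasureTheory

noncomputable section

/-- The `k`-th order Wiener-Wintner average `W_N^k(f)` of `f` for the map `T` and the measure `μ`
(for `k ≥ 1`; the value at `k = 0` is a dummy). Here `Nat.sqrt N = ⌊√N⌋`. -/
def wwAverage {X : Type*} [MeasurableSpace X] (μ : Measure X) (T : X → X) :
    ℕ → ℕ → (X → ℂ) → ℝ
  | 0, _, _ => 0
  | 1, N, f =>
      (eLpNorm (fun x : X => ⨆ t : ℝ,
        ‖(1 / (N : ℂ)) * ∑ n ∈ Finset.Icc 1 N,
          Complex.exp (2 * Real.pi * Complex.I * n * t) * f (T^[n] x)‖) 2 μ).toReal ^ (2 / 3 : ℝ)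
  | k + 2, N, f =>
      (1 / (Nat.sqrt N : ℝ)) * ∑ h ∈ Finset.Icc 1 (Nat.sqrt N),
        wwAverage μ T (k + 1) N (fun x => f x * (starRingEnd ℂ) (f (T^[h] x)))

/-- `Poly(ℕ, α)`: the sequences that are `O(N^{-α})`. -/
def PolyDecayWith (α : ℝ) : Set (ℕ → ℝ) :=
  {r | r =O[Filter.atTop] fun N : ℕ => (N : ℝ) ^ (-α)}

/-- `Poly(ℕ)`: the sequences of polynomial decay. -/
def PolyDecay : Set (ℕ → ℝ) :=
  {r | ∃ α : ℝ, 0 < α ∧ r ∈ PolyDecayWith α}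

/-- The parameters that are allowed in the relation `f ≾ g`. -/
structure PrecsimData where
  α : ℝ
  β : ℝ
  γ : ℝ
  C : ℝ
  N₀ : ℕ
  φ : ℕ → ℕ
  α_pos : 0 < α
  α_le : α ≤ 1
  β_pos : 0 < β
  β_le : β ≤ 1
  γ_pos : 0 < γ
  γ_le : γ ≤ 1
  C_pos : 0 < C
  φ_mono : Monotone φ
  φ_ge : ∀ N : ℕ, (N : ℝ) ^ β ≤ (φ N : ℝ)

/-- The relation `f ≾ g` between nonnegative sequences, with prescribed parameters. -/
def PrecsimWith (D : PrecsimData) (f g : ℕ → ℝ) : Prop :=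
  ∀ N : ℕ, D.N₀ < N → f N ≤ D.C * (1 / (N : ℝ) ^ D.α + g (D.φ N) ^ D.γ)

/-- The relation `f ≾ g` between nonnegative sequences. -/
def Precsim (f g : ℕ → ℝ) : Prop :=
  ∃ D : PrecsimData, PrecsimWith D f g

/-- The relation `f ≈ g` between nonnegative sequences. -/
def PrecsimEquiv (f g : ℕ → ℝ) : Prop :=
  Precsim f g ∧ Precsim g f

end

/-! For `k ≥ 2` the averages `W_N^k` are not visibly subadditive, because `f ↦ f · conj (f ∘ T^h)`
is quadratic. The proof compares them, up to powers, constants and a change of scale, with local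
Gowers forms, which do satisfy a quasi-triangle inequality: `gowersForm` averages the integrals of
iterated products `corr T a b` over boxes of prescribed side lengths.

From above, van der Corput's expansion bounds the supremum over `t` by correlations whose moduli do
not depend on `t`. This controls the sixth power of an average of order `k + 1` by a form with `k`
sides `2⌊√N⌋`, then `2N` and `M` (`wwAverage_pow_six_le_gowersForm`). From below, Parseval bounds
the correlations of an orbit segment by its largest exponential sum (`sum_norm_sq_correlation_le`),
so the form with sides `⌊√M⌋, …, ⌊√M⌋, M, M` is controlled by the average at scale `M`, up to a
diagonal error `O(1/⌊√M⌋)` (`gowersForm_replicate_le_wwAverage`). The two families of sides are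
linked by shrinking: a long orbit average is an average of short ones up to boundary terms
(`gowersForm_replicate_le_of_length`). The quasi-triangle inequality `exists_gowersForm_add_le`
expands the product in one direction and removes the mixed terms by Cauchy-Schwarz.

With `M = ⌊N^{1/4}⌋` the chain gives `W_N(f+g)^6 ≤ C (N^{-1/8} + W_M(f) + W_M(g))` for `f`, `g` and
`f + g` bounded by one. Sixth roots and homogeneity give exponents at least as good as the stated
ones.

The error `N^{-1/48}` would cap the decay rate of a sum, whereas the corollary allows arbitrarily
large `α` and `β`. There is no conflict: by Parseval and a quantitative recurrence argument
(`exists_le_wwAverage`), only the zero function decays faster than `N^{-1/3}`. -/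

open scoped ComplexConjugate

/-! ### Bounded functions and elementary properties of the averages -/

section Basics

variable {X : Type*} [MeasurableSpace X] {μ : Measure X} {T : X → X}

/-- Measurable functions that are bounded everywhere. -/
structure BddMeas (f : X → ℂ) : Prop where
  meas : Measurable f
  bdd : ∃ C : ℝ, ∀ x, ‖f x‖ ≤ C

/-- Measurable functions that are bounded by `1` everywhere. -/
structure UnitMeas (f : X → ℂ) : Prop where
  meas : Measurable f
  le_one : ∀ x, ‖f x‖ ≤ 1

theorem UnitMeas.bddMeas {f : X → ℂ} (hf : UnitMeas f) : BddMeas f := ⟨hf.meas, 1, hf.le_one⟩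

theorem BddMeas.integrable [IsFiniteMeasure μ] {f : X → ℂ} (hf : BddMeas f) :
    Integrable f μ := by
  obtain ⟨C, hC⟩ := hf.bdd
  exact Integrable.of_bound hf.meas.aestronglyMeasurable C (ae_of_all _ hC)

theorem BddMeas.add {f g : X → ℂ} (hf : BddMeas f) (hg : BddMeas g) :
    BddMeas (fun x => f x + g x) := by
  obtain ⟨C, hC⟩ := hf.bdd
  obtain ⟨D, hD⟩ := hg.bdd
  exact ⟨hf.meas.add hg.meas, C + D, fun x => (norm_add_le _ _).trans (add_le_add (hC x) (hD x))⟩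

theorem BddMeas.mul {f g : X → ℂ} (hf : BddMeas f) (hg : BddMeas g) :
    BddMeas (fun x => f x * g x) := by
  obtain ⟨C, hC⟩ := hf.bdd
  obtain ⟨D, hD⟩ := hg.bdd
  refine ⟨hf.meas.mul hg.meas, C * D, fun x => ?_⟩
  rw [norm_mul]
  exact mul_le_mul (hC x) (hD x) (norm_nonneg _) ((norm_nonneg _).trans (hC x))

theorem BddMeas.conj {f : X → ℂ} (hf : BddMeas f) : BddMeas (fun x => conj (f x)) := by
  obtain ⟨C, hC⟩ := hf.bdd
  exact ⟨Complex.continuous_conj.measurable.comp hf.meas, C, fun x => by simpa using hC x⟩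

theorem BddMeas.const_mul {f : X → ℂ} (hf : BddMeas f) (c : ℂ) : BddMeas (fun x => c * f x) :=
  BddMeas.mul ⟨measurable_const, ‖c‖, fun _ => le_rfl⟩ hf

theorem BddMeas.sum {ι : Type*} {s : Finset ι} {f : ι → X → ℂ} (hf : ∀ i ∈ s, BddMeas (f i)) :
    BddMeas (fun x => ∑ i ∈ s, f i x) := by
  classical
  induction s using Finset.induction_on with
  | empty => exact ⟨by simp, 0, by simp⟩
  | insert a s ha ih =>
    simp only [Finset.sum_insert ha]
    exact (hf a (by simp)).add (ih fun i hi => hf i (by simp [hi]))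

theorem BddMeas.comp {f : X → ℂ} (hf : BddMeas f) {S : X → X} (hS : Measurable S) :
    BddMeas (fun x => f (S x)) := by
  obtain ⟨C, hC⟩ := hf.bdd
  exact ⟨hf.meas.comp hS, C, fun x => hC _⟩

theorem BddMeas.integrable_norm_sq [IsFiniteMeasure μ] {f : X → ℂ} (hf : BddMeas f) :
    Integrable (fun x => ‖f x‖ ^ 2) μ := by
  have h := (hf.mul hf.conj).integrable (μ := μ)
  refine h.norm.congr (ae_of_all _ fun x => ?_)
  simp [sq]

theorem UnitMeas.mul {f g : X → ℂ} (hf : UnitMeas f) (hg : UnitMeas g) :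
    UnitMeas (fun x => f x * g x) := by
  refine ⟨hf.meas.mul hg.meas, fun x => ?_⟩
  rw [norm_mul]
  exact mul_le_one₀ (hf.le_one x) (norm_nonneg _) (hg.le_one x)

theorem UnitMeas.conj {f : X → ℂ} (hf : UnitMeas f) : UnitMeas (fun x => conj (f x)) :=
  ⟨hf.bddMeas.conj.meas, fun x => by simpa using hf.le_one x⟩

theorem UnitMeas.comp {f : X → ℂ} (hf : UnitMeas f) {S : X → X} (hS : Measurable S) :
    UnitMeas (fun x => f (S x)) :=
  ⟨hf.meas.comp hS, fun _ => hf.le_one _⟩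

theorem UnitMeas.mul_conj_comp {f : X → ℂ} (hf : UnitMeas f) {S : X → X} (hS : Measurable S) :
    UnitMeas (fun x => f x * conj (f (S x))) :=
  hf.mul (hf.conj.comp hS)

theorem integral_comp_iterate {E : Type*} [NormedAddCommGroup E] [NormedSpace ℝ E]
    (hT : MeasurePreserving T μ μ) (n : ℕ) {F : X → E} (hF : AEStronglyMeasurable F μ) :
    ∫ x, F (T^[n] x) ∂μ = ∫ x, F x ∂μ := by
  have h := hT.iterate n
  rw [← integral_map h.measurable.aemeasurable (by rwa [h.map_eq]), h.map_eq]

/-- The pointwise supremum that occurs in the first Wiener-Wintner average. -/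
noncomputable def wienerSup (T : X → X) (N : ℕ) (f : X → ℂ) (x : X) : ℝ :=
  ⨆ t : ℝ, ‖(1 / (N : ℂ)) * ∑ n ∈ Finset.Icc 1 N,
    Complex.exp (2 * Real.pi * Complex.I * n * t) * f (T^[n] x)‖

theorem norm_exp_two_pi (n : ℕ) (t : ℝ) :
    ‖Complex.exp (2 * Real.pi * Complex.I * n * t)‖ = 1 := by
  have : (2 * Real.pi * Complex.I * n * t : ℂ) = ((2 * Real.pi * n * t : ℝ) : ℂ) * Complex.I := by
    push_cast; ring
  rw [this, Complex.norm_exp_ofReal_mul_I]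

theorem norm_wiener_term_le {Y : Type*} {S : Y → Y} {f : Y → ℂ} {C : ℝ} (hC : 0 ≤ C)
    (hf : ∀ x, ‖f x‖ ≤ C) (N : ℕ) (x : Y) (t : ℝ) : ‖(1 / (N : ℂ)) * ∑ n ∈ Finset.Icc 1 N,
      Complex.exp (2 * Real.pi * Complex.I * n * t) * f (S^[n] x)‖ ≤ C := by
  have h : ‖∑ n ∈ Finset.Icc 1 N,
      Complex.exp (2 * Real.pi * Complex.I * n * t) * f (S^[n] x)‖ ≤ N * C := by
    refine (norm_sum_le _ _).trans ((Finset.sum_le_card_nsmul _ _ C fun n _ => ?_).trans (by simp))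
    rw [norm_mul, norm_exp_two_pi, one_mul]
    exact hf _
  rw [norm_mul]
  rcases Nat.eq_zero_or_pos N with rfl | hN
  · simpa using hC
  · have hN' : (0 : ℝ) < N := by exact_mod_cast hN
    have : ‖(1 / (N : ℂ))‖ = 1 / N := by simp
    rw [this, one_div, inv_mul_le_iff₀ hN']
    exact h

theorem bddAbove_wiener {f : X → ℂ} (hf : BddMeas f) (N : ℕ) (x : X) :
    BddAbove (Set.range fun t : ℝ => ‖(1 / (N : ℂ)) * ∑ n ∈ Finset.Icc 1 N,
      Complex.exp (2 * Real.pi * Complex.I * n * t) * f (T^[n] x)‖) := by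
  obtain ⟨C, hC⟩ := hf.bdd
  refine ⟨C, ?_⟩
  rintro _ ⟨t, rfl⟩
  exact norm_wiener_term_le ((norm_nonneg _).trans (hC x)) hC N x t

theorem le_wienerSup {f : X → ℂ} (hf : BddMeas f) (N : ℕ) (x : X) (t : ℝ) :
    ‖(1 / (N : ℂ)) * ∑ n ∈ Finset.Icc 1 N,
      Complex.exp (2 * Real.pi * Complex.I * n * t) * f (T^[n] x)‖ ≤ wienerSup T N f x :=
  le_ciSup (bddAbove_wiener hf N x) t

theorem wienerSup_nonneg {Y : Type*} {S : Y → Y} (N : ℕ) (f : Y → ℂ) (x : Y) :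
    0 ≤ wienerSup S N f x :=
  Real.iSup_nonneg fun _ => norm_nonneg _

theorem wienerSup_le {Y : Type*} {S : Y → Y} {f : Y → ℂ} {C : ℝ} (hC : 0 ≤ C)
    (hf : ∀ x, ‖f x‖ ≤ C) (N : ℕ) (x : Y) : wienerSup S N f x ≤ C :=
  ciSup_le fun t => norm_wiener_term_le hC hf N x t

/-- The exponential sum is continuous in `t`, so the supremum may be taken over the countable dense
set of rationals. -/
theorem measurable_wienerSup (hT : Measurable T) {f : X → ℂ} (hf : BddMeas f) (N : ℕ) :
    Measurable (wienerSup T N f) := by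
  have h : ∀ x, wienerSup T N f x = ⨆ q : ℚ, ‖(1 / (N : ℂ)) * ∑ n ∈ Finset.Icc 1 N,
      Complex.exp (2 * Real.pi * Complex.I * n * ((q : ℝ) : ℂ)) * f (T^[n] x)‖ := by
    intro x
    set F : ℝ → ℝ := fun t => ‖(1 / (N : ℂ)) * ∑ n ∈ Finset.Icc 1 N,
      Complex.exp (2 * Real.pi * Complex.I * n * t) * f (T^[n] x)‖ with hF
    have hcont : Continuous F := by
      rw [hF]; fun_prop
    have hb : BddAbove (Set.range fun q : ℚ => F q) := by
      obtain ⟨C, hC⟩ := bddAbove_wiener (T := T) hf N x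
      exact ⟨C, by rintro _ ⟨q, rfl⟩; exact hC ⟨(q : ℝ), rfl⟩⟩
    refine le_antisymm (ciSup_le fun t => ?_) (ciSup_le fun q => le_wienerSup hf N x q)
    have hcl : IsClosed {t : ℝ | F t ≤ ⨆ q : ℚ, F q} := isClosed_le hcont continuous_const
    have hsub : Set.range ((↑) : ℚ → ℝ) ⊆ {t : ℝ | F t ≤ ⨆ q : ℚ, F q} := by
      rintro _ ⟨q, rfl⟩
      exact le_ciSup hb q
    exact hcl.closure_subset_iff.2 hsub (Rat.denseRange_cast t)
  rw [funext h]
  refine Measurable.iSup fun q => ?_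
  refine Measurable.norm (Measurable.const_mul (Finset.measurable_fun_sum _ fun n _ => ?_) _)
  exact (hf.meas.comp (hT.iterate n)).const_mul _

theorem integrable_wienerSup_pow [IsFiniteMeasure μ] (hT : Measurable T) {f : X → ℂ}
    (hf : BddMeas f) (N m : ℕ) : Integrable (fun x => wienerSup T N f x ^ m) μ := by
  obtain ⟨C, hC⟩ := hf.bdd
  refine Integrable.of_bound ((measurable_wienerSup hT hf N).pow_const m).aestronglyMeasurable
    (|C| ^ m) (ae_of_all _ fun x => ?_)
  rw [Real.norm_of_nonneg (pow_nonneg (wienerSup_nonneg _ _ _) _)]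
  exact pow_le_pow_left₀ (wienerSup_nonneg _ _ _)
    (wienerSup_le (abs_nonneg _) (fun y => (hC y).trans (le_abs_self _)) N x) _

theorem wwAverage_one (N : ℕ) (f : X → ℂ) :
    wwAverage μ T 1 N f = (eLpNorm (wienerSup T N f) 2 μ).toReal ^ (2 / 3 : ℝ) := by
  simp only [wwAverage]; rfl

theorem wwAverage_succ_succ (k N : ℕ) (f : X → ℂ) :
    wwAverage μ T (k + 2) N f = (1 / (Nat.sqrt N : ℝ)) * ∑ h ∈ Finset.Icc 1 (Nat.sqrt N),
        wwAverage μ T (k + 1) N (fun x => f x * conj (f (T^[h] x))) := by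
  simp only [wwAverage]

theorem wwAverage_one_pow_three [IsFiniteMeasure μ] (hT : Measurable T) {f : X → ℂ}
    (hf : BddMeas f) (N : ℕ) :
    wwAverage μ T 1 N f ^ 3 = ∫ x, wienerSup T N f x ^ 2 ∂μ := by
  have hI : 0 ≤ ∫ x, wienerSup T N f x ^ 2 ∂μ := integral_nonneg fun x => sq_nonneg _
  have hmem : MemLp (wienerSup T N f) 2 μ := by
    rw [memLp_two_iff_integrable_sq (measurable_wienerSup hT hf N).aestronglyMeasurable]
    exact integrable_wienerSup_pow hT hf N 2
  have h2 : (eLpNorm (wienerSup T N f) 2 μ).toReal = (∫ x, wienerSup T N f x ^ 2 ∂μ) ^ (1/2 : ℝ) := by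
    rw [hmem.eLpNorm_eq_integral_rpow_norm (by norm_num) (by norm_num)]
    rw [ENNReal.toReal_ofReal (by positivity)]
    norm_num
  rw [wwAverage_one, h2, ← Real.rpow_mul hI, ← Real.rpow_natCast, ← Real.rpow_mul hI]
  norm_num

theorem wwAverage_nonneg (k N : ℕ) (f : X → ℂ) : 0 ≤ wwAverage μ T k N f := by
  induction k using Nat.twoStepInduction generalizing f with
  | zero => simp [wwAverage]
  | one => rw [wwAverage_one]; positivity
  | more k _ ih =>
    rw [wwAverage_succ_succ]
    exact mul_nonneg (by positivity) (Finset.sum_nonneg fun h _ => ih _)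

theorem wwAverage_congr_ae (hT : MeasurePreserving T μ μ) (k N : ℕ) {f g : X → ℂ}
    (hfg : f =ᵐ[μ] g) : wwAverage μ T k N f = wwAverage μ T k N g := by
  have hn : ∀ n, (fun x => f (T^[n] x)) =ᵐ[μ] fun x => g (T^[n] x) := fun n =>
    (hT.iterate n).quasiMeasurePreserving.ae_eq_comp hfg
  induction k using Nat.twoStepInduction generalizing f g with
  | zero => simp [wwAverage]
  | one =>
    rw [wwAverage_one, wwAverage_one]
    congr 2
    refine eLpNorm_congr_ae ?_
    filter_upwards [ae_all_iff.2 hn] with x hx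
    simp only [wienerSup, hx]
  | more k _ ih =>
    rw [wwAverage_succ_succ, wwAverage_succ_succ]
    congr 1
    refine Finset.sum_congr rfl fun h _ => ?_
    have hh : (fun x => f x * conj (f (T^[h] x))) =ᵐ[μ] fun x => g x * conj (g (T^[h] x)) := by
      filter_upwards [hfg, hn h] with x h1 h2
      rw [h1, h2]
    exact ih hh fun n => (hT.iterate n).quasiMeasurePreserving.ae_eq_comp hh

/-- The first order has degree `2/3`, and every multiplicative difference replaces the scalar `c` by
`|c|²`, doubling the degree. -/
theorem wwAverage_const_mul (k N : ℕ) (c : ℂ) (f : X → ℂ) :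
    wwAverage μ T (k + 1) N (fun x => c * f x) =
      ‖c‖ ^ (2 ^ (k + 1) / 3 : ℝ) * wwAverage μ T (k + 1) N f := by
  induction k generalizing c f with
  | zero =>
    have h : wienerSup T N (fun x => c * f x) = fun x => ‖c‖ * wienerSup T N f x := by
      funext x
      simp only [wienerSup]
      rw [Real.mul_iSup_of_nonneg (norm_nonneg _)]
      congr 1
      funext t
      rw [← norm_mul]
      congr 1
      simp only [Finset.mul_sum]
      refine Finset.sum_congr rfl fun n _ => by ring
    have h' : (fun x => ‖c‖ * wienerSup T N f x) = ‖c‖ • wienerSup T N f := rfl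
    rw [zero_add, wwAverage_one, wwAverage_one, h, h', eLpNorm_const_smul, ENNReal.toReal_mul,
      Real.mul_rpow (by simp) (by simp)]
    simp
  | succ k ih =>
    rw [wwAverage_succ_succ, wwAverage_succ_succ, mul_left_comm]
    congr 1
    rw [Finset.mul_sum]
    refine Finset.sum_congr rfl fun h _ => ?_
    have e : (fun x => c * f x * conj (c * f (T^[h] x))) =
        fun x => (c * conj c) * (f x * conj (f (T^[h] x))) := by
      funext x
      rw [map_mul]; ring
    rw [e, ih]
    congr 1
    rw [norm_mul, RCLike.norm_conj, ← sq, ← Real.rpow_natCast, ← Real.rpow_mul (norm_nonneg _)]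
    congr 1
    push_cast
    ring

theorem wwAverage_le_one [IsProbabilityMeasure μ] (hT : Measurable T) (k N : ℕ) {f : X → ℂ}
    (hf : UnitMeas f) : wwAverage μ T k N f ≤ 1 := by
  induction k using Nat.twoStepInduction generalizing f with
  | zero => simp [wwAverage]
  | one =>
    refine (pow_le_one_iff_of_nonneg (wwAverage_nonneg _ _ _) (n := 3) (by norm_num)).1 ?_
    rw [wwAverage_one_pow_three hT hf.bddMeas]
    calc ∫ x, wienerSup T N f x ^ 2 ∂μ ≤ ∫ _, (1 : ℝ) ∂μ := by
          refine integral_mono (integrable_wienerSup_pow hT hf.bddMeas N 2)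
            (integrable_const _) fun x => ?_
          exact pow_le_one₀ (wienerSup_nonneg _ _ _) (wienerSup_le zero_le_one hf.le_one N x)
      _ = 1 := by simp
  | more k _ ih =>
    rw [wwAverage_succ_succ, one_div]
    refine inv_mul_le_one_of_le₀ ?_ (Nat.cast_nonneg _)
    refine (Finset.sum_le_card_nsmul _ _ 1 fun h _ =>
      ih (hf.mul_conj_comp (hT.iterate h))).trans ?_
    simp

end Basics

/-! ### Local Gowers forms: positivity, change of side length, quasi-triangle inequality -/

section Forms

variable {X : Type*} [MeasurableSpace X] {μ : Measure X} {T : X → X}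

/-- The product of `f ∘ T^a` and the complex conjugate of `g ∘ T^b`. -/
def corr {X : Type*} (T : X → X) (a b : ℕ) (f g : X → ℂ) : X → ℂ :=
  fun x => f (T^[a] x) * conj (g (T^[b] x))

/-- The average of `f ∘ T^n` over `1 ≤ n ≤ L`. -/
noncomputable def orbitAvg {X : Type*} (T : X → X) (L : ℕ) (f : X → ℂ) : X → ℂ :=
  fun x => (1 / (L : ℂ)) * ∑ a ∈ Finset.Icc 1 L, f (T^[a] x)

/-- The local Gowers form of `f` with side lengths `Ls`. -/
noncomputable def gowersForm (μ : Measure X) (T : X → X) : List ℕ → (X → ℂ) → ℝ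
  | [], f => (∫ x, f x ∂μ).re
  | L :: Ls, f => (1 / (L : ℝ) ^ 2) * ∑ a ∈ Finset.Icc 1 L, ∑ b ∈ Finset.Icc 1 L,
      gowersForm μ T Ls (corr T a b f f)

/-- The polarization of the local Gowers form in its first coordinate. -/
noncomputable def crossForm (μ : Measure X) (T : X → X) (L : ℕ) (Ls : List ℕ) (f g : X → ℂ) : ℝ :=
  (1 / (L : ℝ) ^ 2) * ∑ a ∈ Finset.Icc 1 L, ∑ b ∈ Finset.Icc 1 L, gowersForm μ T Ls (corr T a b f g)

theorem gowersForm_cons (L : ℕ) (Ls : List ℕ) (f : X → ℂ) :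
    gowersForm μ T (L :: Ls) f = crossForm μ T L Ls f f := rfl

/-- Powers of `T` commute, so differences in two directions may be interchanged. -/
theorem corr_corr {Y : Type*} {S : Y → Y} (a b a' b' : ℕ) (f g : Y → ℂ) :
    corr S a' b' (corr S a b f g) (corr S a b f g) =
      corr S a b (corr S a' b' f f) (corr S a' b' g g) := by
  funext x
  have h : ∀ m n : ℕ, S^[m] (S^[n] x) = S^[n] (S^[m] x) := fun m n => by
    rw [← Function.iterate_add_apply, ← Function.iterate_add_apply, add_comm]
  simp only [corr, map_mul, Complex.conj_conj, h a, h b]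
  ring

theorem BddMeas.corr (hT : Measurable T) (a b : ℕ) {f g : X → ℂ} (hf : BddMeas f)
    (hg : BddMeas g) : BddMeas (corr T a b f g) :=
  (hf.comp (hT.iterate a)).mul (hg.conj.comp (hT.iterate b))

theorem UnitMeas.corr (hT : Measurable T) (a b : ℕ) {f g : X → ℂ} (hf : UnitMeas f)
    (hg : UnitMeas g) : UnitMeas (corr T a b f g) :=
  (hf.comp (hT.iterate a)).mul (hg.conj.comp (hT.iterate b))

theorem BddMeas.orbitAvg (hT : Measurable T) (L : ℕ) {f : X → ℂ} (hf : BddMeas f) :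
    BddMeas (orbitAvg T L f) :=
  BddMeas.const_mul (BddMeas.sum fun a _ => hf.comp (hT.iterate a)) _

/-- Moves the polarized direction past the next one. Iterating brings it innermost, where
`crossForm_nil` makes it an `L²` inner product of orbit averages; facts about one direction thus
reduce to the empty list. -/
theorem crossForm_cons (L L' : ℕ) (Ls : List ℕ) (f g : X → ℂ) :
    crossForm μ T L (L' :: Ls) f g = (1 / (L' : ℝ) ^ 2) * ∑ a ∈ Finset.Icc 1 L',
      ∑ b ∈ Finset.Icc 1 L', crossForm μ T L Ls (corr T a b f f) (corr T a b g g) := by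
  simp only [crossForm, gowersForm, corr_corr, ← Finset.mul_sum]
  rw [mul_left_comm]
  congr 2
  calc _ = ∑ a ∈ Finset.Icc 1 L, ∑ a' ∈ Finset.Icc 1 L', ∑ b ∈ Finset.Icc 1 L,
        ∑ b' ∈ Finset.Icc 1 L',
          gowersForm μ T Ls (corr T a b (corr T a' b' f f) (corr T a' b' g g)) :=
        Finset.sum_congr rfl fun a _ => Finset.sum_comm
    _ = _ := by
        rw [Finset.sum_comm]
        refine Finset.sum_congr rfl fun a' _ => ?_
        calc _ = ∑ a ∈ Finset.Icc 1 L, ∑ b' ∈ Finset.Icc 1 L', ∑ b ∈ Finset.Icc 1 L,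
              gowersForm μ T Ls (corr T a b (corr T a' b' f f) (corr T a' b' g g)) :=
              Finset.sum_congr rfl fun a _ => Finset.sum_comm
          _ = _ := Finset.sum_comm

theorem crossForm_nil [IsFiniteMeasure μ] (hT : Measurable T) (L : ℕ) {f g : X → ℂ}
    (hf : BddMeas f) (hg : BddMeas g) :
    crossForm μ T L [] f g = (∫ x, orbitAvg T L f x * conj (orbitAvg T L g x) ∂μ).re := by
  have e : (fun x => orbitAvg T L f x * conj (orbitAvg T L g x)) = fun x =>
      ((1 / (L : ℝ) ^ 2 : ℝ) : ℂ) * ∑ a ∈ Finset.Icc 1 L, ∑ b ∈ Finset.Icc 1 L,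
        corr T a b f g x := by
    funext x
    simp only [orbitAvg, corr, ← Finset.sum_mul_sum, map_mul, map_sum]
    simp only [map_div₀, map_one, Complex.conj_natCast]
    push_cast
    ring
  have hi : ∀ a b, Integrable (corr T a b f g) μ := fun a b => (hf.corr hT a b hg).integrable
  rw [e, integral_const_mul, Complex.re_ofReal_mul, integral_finsetSum _ fun a _ =>
    integrable_finsetSum _ fun b _ => hi a b]
  simp only [crossForm, gowersForm, Complex.re_sum]
  congr 1
  refine Finset.sum_congr rfl fun a _ => ?_
  rw [integral_finsetSum _ fun b _ => hi a b, Complex.re_sum]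

theorem crossForm_nil_self [IsFiniteMeasure μ] (hT : Measurable T) (L : ℕ) {f : X → ℂ}
    (hf : BddMeas f) : crossForm μ T L [] f f = ∫ x, ‖orbitAvg T L f x‖ ^ 2 ∂μ := by
  rw [crossForm_nil hT L hf hf]
  have : (fun x => orbitAvg T L f x * conj (orbitAvg T L f x)) = fun x =>
      ((‖orbitAvg T L f x‖ ^ 2 : ℝ) : ℂ) := by
    funext x
    rw [Complex.mul_conj, Complex.normSq_eq_norm_sq]
  rw [this, integral_complex_ofReal, Complex.ofReal_re]

theorem crossForm_self_nonneg [IsFiniteMeasure μ] (hT : Measurable T) (L : ℕ) (Ls : List ℕ)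
    {f : X → ℂ} (hf : BddMeas f) : 0 ≤ crossForm μ T L Ls f f := by
  induction Ls generalizing f with
  | nil => rw [crossForm_nil_self hT L hf]; exact integral_nonneg fun x => sq_nonneg _
  | cons L' Ls ih =>
    rw [crossForm_cons]
    exact mul_nonneg (by positivity) (Finset.sum_nonneg fun a _ => Finset.sum_nonneg fun b _ =>
      ih (hf.corr hT a b hf))

/-- An average over `[1, L]²` is monotone. -/
theorem avg_sq_mono (L : ℕ) {u v : ℕ → ℕ → ℝ} (h : ∀ a b, u a b ≤ v a b) :
    (1 / (L : ℝ) ^ 2) * ∑ a ∈ Finset.Icc 1 L, ∑ b ∈ Finset.Icc 1 L, u a b ≤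
      (1 / (L : ℝ) ^ 2) * ∑ a ∈ Finset.Icc 1 L, ∑ b ∈ Finset.Icc 1 L, v a b :=
  mul_le_mul_of_nonneg_left (Finset.sum_le_sum fun a _ => Finset.sum_le_sum fun b _ => h a b)
    (by positivity)

theorem avg_sq_const_le (L : ℕ) {c : ℝ} (hc : 0 ≤ c) :
    (1 / (L : ℝ) ^ 2) * ∑ _a ∈ Finset.Icc 1 L, ∑ _b ∈ Finset.Icc 1 L, c ≤ c := by
  simp only [Finset.sum_const, Nat.card_Icc, Nat.add_sub_cancel, nsmul_eq_mul]
  rcases Nat.eq_zero_or_pos L with rfl | hL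
  · simpa using hc
  · have : (0 : ℝ) < L := by exact_mod_cast hL
    field_simp
    exact le_rfl

/-- The Cauchy-Schwarz inequality for the polarized form. -/
theorem crossForm_le [IsFiniteMeasure μ] (hT : Measurable T) (L : ℕ) (Ls : List ℕ)
    {f g : X → ℂ} (hf : BddMeas f) (hg : BddMeas g) :
    crossForm μ T L Ls f g ≤ (crossForm μ T L Ls f f + crossForm μ T L Ls g g) / 2 := by
  induction Ls generalizing f g with
  -- In the innermost position this is `Re ⟨F, G⟩ ≤ (‖F‖² + ‖G‖²) / 2` for the orbit averages `F`
  -- and `G`.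
  | nil =>
    rw [crossForm_nil hT L hf hg, crossForm_nil_self hT L hf, crossForm_nil_self hT L hg]
    have hF := hf.orbitAvg hT L
    have hG := hg.orbitAvg hT L
    rw [← integral_add hF.integrable_norm_sq hG.integrable_norm_sq, ← integral_div]
    calc _ ≤ ‖∫ x, orbitAvg T L f x * conj (orbitAvg T L g x) ∂μ‖ := Complex.re_le_norm _
      _ ≤ ∫ x, ‖orbitAvg T L f x * conj (orbitAvg T L g x)‖ ∂μ := norm_integral_le_integral_norm _
      _ ≤ _ := by
        refine integral_mono (hF.mul hG.conj).integrable.norm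
          ((hF.integrable_norm_sq.add hG.integrable_norm_sq).div_const 2) fun x => ?_
        simp only [norm_mul, RCLike.norm_conj]
        nlinarith [sq_nonneg (‖orbitAvg T L f x‖ - ‖orbitAvg T L g x‖)]
  | cons L' Ls ih =>
    simp only [crossForm_cons]
    rw [← mul_add, mul_div_assoc, ← Finset.sum_add_distrib, Finset.sum_div]
    simp only [← Finset.sum_add_distrib, Finset.sum_div]
    exact avg_sq_mono L' fun a b => ih (hf.corr hT a b hf) (hg.corr hT a b hg)

/-- Each unit shift exchanges one endpoint term for another and so costs at most `2`. -/
theorem norm_sum_shift_sub_le {u : ℕ → ℂ} (hu : ∀ n, ‖u n‖ ≤ 1) (L a : ℕ) :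
    ‖∑ m ∈ Finset.Icc 1 L, u (m + a) - ∑ m ∈ Finset.Icc 1 L, u m‖ ≤ 2 * a := by
  induction a with
  | zero => simp
  | succ a ih =>
    have h : ∑ m ∈ Finset.Icc 1 L, u (m + (a + 1)) - ∑ m ∈ Finset.Icc 1 L, u (m + a) =
        u (L + a + 1) - u (1 + a) := by
      rw [← Finset.sum_sub_distrib]
      clear ih
      induction L with
      | zero => simp [add_comm]
      | succ L ih =>
        rw [Finset.sum_Icc_succ_top (by omega), ih]
        rw [show L + 1 + (a + 1) = L + 1 + a + 1 by omega, show L + 1 + a = L + a + 1 by omega]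
        ring
    calc _ = ‖(∑ m ∈ Finset.Icc 1 L, u (m + a) - ∑ m ∈ Finset.Icc 1 L, u m) +
          (u (L + a + 1) - u (1 + a))‖ := by rw [← h]; congr 1; ring
      _ ≤ 2 * a + (1 + 1) := (norm_add_le _ _).trans
          (add_le_add ih ((norm_sub_le _ _).trans (add_le_add (hu _) (hu _))))
      _ = _ := by push_cast; ring

/-- A long average is controlled in `L²` by short averages. -/
theorem integral_norm_sum_sq_le [IsProbabilityMeasure μ] (hT : MeasurePreserving T μ μ)
    {g : X → ℂ} (hg : UnitMeas g) {n N l : ℕ} (hn : n ≤ N) (hN : 1 ≤ N) (hl : 1 ≤ l) :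
    ∫ x, ‖(1 / (N : ℂ)) * ∑ a ∈ Finset.Icc 1 n, g (T^[a] x)‖ ^ 2 ∂μ ≤
      2 * (∫ x, ‖orbitAvg T l g x‖ ^ 2 ∂μ) + 8 * ((l : ℝ) / N) ^ 2 := by
  have hN' : (0 : ℝ) < N := by exact_mod_cast hN
  have hl' : (0 : ℝ) < l := by exact_mod_cast hl
  have hA := hg.bddMeas.orbitAvg hT.measurable l
  have hpt : ∀ x, ‖(1 / (N : ℂ)) * ∑ a ∈ Finset.Icc 1 n, g (T^[a] x)‖ ^ 2 ≤
      2 * ((1 / (N : ℝ)) * ∑ m ∈ Finset.Icc 1 n, ‖orbitAvg T l g (T^[m] x)‖ ^ 2)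
        + 8 * ((l : ℝ) / N) ^ 2 := by
    intro x
    set u : ℕ → ℂ := fun j => g (T^[j] x) with hu
    have hu1 : ∀ j, ‖u j‖ ≤ 1 := fun j => hg.le_one _
    have hAu : ∀ m, orbitAvg T l g (T^[m] x) = (1 / (l : ℂ)) * ∑ a ∈ Finset.Icc 1 l, u (m + a) := by
      intro m
      simp only [orbitAvg, hu, ← Function.iterate_add_apply]
      simp only [add_comm]
    set s := ∑ a ∈ Finset.Icc 1 n, u a with hs
    set B := ∑ m ∈ Finset.Icc 1 n, orbitAvg T l g (T^[m] x) with hB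
    have h1 : ‖s - B‖ ≤ 2 * l := by
      -- `l · B` is the sum over `a ≤ l` of the sums of `u` shifted by `a`, so only boundary terms
      -- remain in the difference.
      have e : (l : ℂ) * (s - B) = - ∑ a ∈ Finset.Icc 1 l,
          (∑ m ∈ Finset.Icc 1 n, u (m + a) - ∑ m ∈ Finset.Icc 1 n, u m) := by
        have hlc : (l : ℂ) ≠ 0 := by exact_mod_cast hl'.ne'
        rw [hB, Finset.sum_congr rfl fun m _ => hAu m, ← Finset.mul_sum, Finset.sum_comm,
          Finset.sum_sub_distrib]
        simp only [Finset.sum_const, Nat.card_Icc, Nat.add_sub_cancel, nsmul_eq_mul, ← hs]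
        field_simp
        ring
      have h2 : ‖(l : ℂ) * (s - B)‖ ≤ l * (2 * l) := by
        rw [e, norm_neg]
        refine (norm_sum_le _ _).trans ((Finset.sum_le_card_nsmul _ _ (2 * (l : ℝ))
          fun a ha => ?_).trans (by simp))
        refine (norm_sum_shift_sub_le hu1 n a).trans ?_
        have : a ≤ l := (Finset.mem_Icc.1 ha).2
        have : (a : ℝ) ≤ l := by exact_mod_cast this
        linarith
      rw [norm_mul, Complex.norm_natCast] at h2
      exact le_of_mul_le_mul_left h2 hl'
    have h3 : ‖B‖ ^ 2 ≤ N * ∑ m ∈ Finset.Icc 1 n, ‖orbitAvg T l g (T^[m] x)‖ ^ 2 := by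
      calc ‖B‖ ^ 2 ≤ (∑ m ∈ Finset.Icc 1 n, ‖orbitAvg T l g (T^[m] x)‖) ^ 2 :=
            pow_le_pow_left₀ (norm_nonneg _) (norm_sum_le _ _) 2
        _ ≤ (Finset.Icc 1 n).card * ∑ m ∈ Finset.Icc 1 n, ‖orbitAvg T l g (T^[m] x)‖ ^ 2 :=
            sq_sum_le_card_mul_sum_sq
        _ ≤ _ := by
            refine mul_le_mul_of_nonneg_right ?_ (Finset.sum_nonneg fun _ _ => sq_nonneg _)
            simpa using hn
    have h4 : ‖s‖ ^ 2 ≤ 2 * ‖B‖ ^ 2 + 8 * (l : ℝ) ^ 2 := by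
      have : ‖s‖ ≤ ‖B‖ + 2 * l := by
        calc ‖s‖ = ‖B + (s - B)‖ := by congr 1; ring
          _ ≤ _ := (norm_add_le _ _).trans (by linarith)
      nlinarith [norm_nonneg s, norm_nonneg B, sq_nonneg (‖B‖ - 2 * l)]
    rw [norm_mul, mul_pow]
    have : ‖(1 / (N : ℂ))‖ = 1 / N := by simp
    rw [this]
    calc (1 / (N : ℝ)) ^ 2 * ‖s‖ ^ 2 ≤ (1 / (N : ℝ)) ^ 2 * (2 * (N * ∑ m ∈ Finset.Icc 1 n,
          ‖orbitAvg T l g (T^[m] x)‖ ^ 2) + 8 * (l : ℝ) ^ 2) :=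
          mul_le_mul_of_nonneg_left (by linarith) (by positivity)
      _ = _ := by field_simp
  have hint : ∀ m, Integrable (fun x => ‖orbitAvg T l g (T^[m] x)‖ ^ 2) μ := fun m =>
    (hA.comp (hT.measurable.iterate m)).integrable_norm_sq
  have hsum : Integrable (fun x => ∑ m ∈ Finset.Icc 1 n, ‖orbitAvg T l g (T^[m] x)‖ ^ 2) μ :=
    integrable_finsetSum _ fun m _ => hint m
  have hlhs : BddMeas (fun x => (1 / (N : ℂ)) * ∑ a ∈ Finset.Icc 1 n, g (T^[a] x)) :=
    BddMeas.const_mul (BddMeas.sum fun a _ => hg.bddMeas.comp (hT.measurable.iterate a)) _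
  refine (integral_mono hlhs.integrable_norm_sq
    (((hsum.const_mul _).const_mul _).add (integrable_const _)) hpt).trans ?_
  rw [integral_add' ((hsum.const_mul _).const_mul _) (integrable_const _), integral_const_mul,
    integral_const_mul, integral_finsetSum _ fun m _ => hint m]
  have hinv : ∀ m, ∫ x, ‖orbitAvg T l g (T^[m] x)‖ ^ 2 ∂μ = ∫ x, ‖orbitAvg T l g x‖ ^ 2 ∂μ :=
    fun m => integral_comp_iterate hT m hA.integrable_norm_sq.aestronglyMeasurable
  simp only [hinv, Finset.sum_const, Nat.card_Icc, Nat.add_sub_cancel, nsmul_eq_mul, integral_const,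
    probReal_univ, one_smul]
  have hI : 0 ≤ ∫ x, ‖orbitAvg T l g x‖ ^ 2 ∂μ := integral_nonneg fun x => sq_nonneg _
  have : (n : ℝ) / N ≤ 1 := by
    rw [div_le_one hN']; exact_mod_cast hn
  have h5 : 1 / (N : ℝ) * (n * ∫ x, ‖orbitAvg T l g x‖ ^ 2 ∂μ) ≤ ∫ x, ‖orbitAvg T l g x‖ ^ 2 ∂μ := by
    rw [← mul_assoc, one_div_mul_eq_div]
    exact mul_le_of_le_one_left hI this
  linarith

theorem crossForm_self_le_of_length [IsProbabilityMeasure μ] (hT : MeasurePreserving T μ μ)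
    {L l : ℕ} (hL : 1 ≤ L) (hl : 1 ≤ l) (Ls : List ℕ) {f : X → ℂ} (hf : UnitMeas f) :
    crossForm μ T L Ls f f ≤ 2 * crossForm μ T l Ls f f + 8 * ((l : ℝ) / L) ^ 2 := by
  induction Ls generalizing f with
  | nil =>
    rw [crossForm_nil_self hT.measurable L hf.bddMeas, crossForm_nil_self hT.measurable l hf.bddMeas]
    exact integral_norm_sum_sq_le hT hf le_rfl hL hl
  | cons L' Ls ih =>
    simp only [crossForm_cons]
    refine (avg_sq_mono L' fun a b => ih (hf.corr hT.measurable a b hf)).trans ?_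
    simp only [Finset.sum_add_distrib, ← Finset.mul_sum, mul_add]
    refine add_le_add (le_of_eq (by ring)) ?_
    simpa only [Finset.mul_sum] using avg_sq_const_le L' (c := 8 * ((l : ℝ) / L) ^ 2) (by positivity)

/-- At least one side is needed: for the empty list the form is the real part of an integral, with
no sign. -/
theorem gowersForm_nonneg [IsFiniteMeasure μ] (hT : Measurable T) {Ls : List ℕ} (hLs : Ls ≠ [])
    {f : X → ℂ} (hf : BddMeas f) : 0 ≤ gowersForm μ T Ls f := by
  cases Ls with
  | nil => exact absurd rfl hLs
  | cons L Ls => exact crossForm_self_nonneg hT L Ls hf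

theorem gowersForm_le_one [IsProbabilityMeasure μ] (hT : Measurable T) (Ls : List ℕ)
    {f : X → ℂ} (hf : UnitMeas f) : gowersForm μ T Ls f ≤ 1 := by
  induction Ls generalizing f with
  | nil =>
    refine (Complex.re_le_norm _).trans ((norm_integral_le_of_norm_le_const
      (ae_of_all _ hf.le_one)).trans ?_)
    simp
  | cons L Ls ih =>
    exact (avg_sq_mono L fun a b => ih (hf.corr hT a b hf)).trans (avg_sq_const_le L zero_le_one)

/-- Passing to other side lengths in the local Gowers form. -/
theorem gowersForm_cons_le_cons {A ε : ℝ} (hε : 0 ≤ ε) (hT : Measurable T) {Ls Ls' : List ℕ}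
    (h : ∀ f : X → ℂ, UnitMeas f → gowersForm μ T Ls f ≤ A * gowersForm μ T Ls' f + ε)
    (L : ℕ) {f : X → ℂ} (hf : UnitMeas f) :
    gowersForm μ T (L :: Ls) f ≤ A * gowersForm μ T (L :: Ls') f + ε := by
  refine (avg_sq_mono L fun a b => h _ (hf.corr hT a b hf)).trans ?_
  simp only [Finset.sum_add_distrib, ← Finset.mul_sum, mul_add]
  refine add_le_add (le_of_eq ?_) (avg_sq_const_le L hε)
  simp only [gowersForm]
  ring

theorem crossForm_nil_self_add_le [IsFiniteMeasure μ] (hT : Measurable T) (L : ℕ) {f g : X → ℂ}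
    (hf : BddMeas f) (hg : BddMeas g) :
    crossForm μ T L [] (fun x => f x + g x) (fun x => f x + g x) ≤
      2 * (crossForm μ T L [] f f + crossForm μ T L [] g g) := by
  rw [crossForm_nil_self hT L (hf.add hg), crossForm_nil_self hT L hf, crossForm_nil_self hT L hg]
  have hF := (hf.orbitAvg hT L).integrable_norm_sq (μ := μ)
  have hG := (hg.orbitAvg hT L).integrable_norm_sq (μ := μ)
  rw [← integral_add hF hG, ← integral_const_mul]
  refine integral_mono ((hf.add hg).orbitAvg hT L).integrable_norm_sq ((hF.add hG).const_mul 2)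
    fun x => ?_
  have e : orbitAvg T L (fun x => f x + g x) x = orbitAvg T L f x + orbitAvg T L g x := by
    simp only [orbitAvg, Finset.sum_add_distrib, mul_add]
  simp only [e]
  nlinarith [norm_add_le (orbitAvg T L f x) (orbitAvg T L g x), norm_nonneg (orbitAvg T L f x),
    norm_nonneg (orbitAvg T L f x + orbitAvg T L g x), norm_nonneg (orbitAvg T L g x),
    sq_nonneg (‖orbitAvg T L f x‖ - ‖orbitAvg T L g x‖)]

/-- The quasi-triangle inequality for local Gowers forms, with a constant that depends only on the
number of side lengths. -/
theorem exists_gowersForm_add_le (d : ℕ) : ∃ C : ℝ, 0 < C ∧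
    ∀ {X : Type*} [MeasurableSpace X] {μ : Measure X} [IsFiniteMeasure μ] {T : X → X},
      Measurable T → ∀ Ls : List ℕ, Ls.length = d + 1 → ∀ f g : X → ℂ, BddMeas f → BddMeas g →
        gowersForm μ T Ls (fun x => f x + g x) ≤
          C * (gowersForm μ T Ls f + gowersForm μ T Ls g) := by
  induction d with
  | zero =>
    refine ⟨2, two_pos, fun {X} _ {μ} _ {T} hT Ls hLs f g hf hg => ?_⟩
    obtain ⟨L, rfl⟩ := List.length_eq_one_iff.1 hLs
    exact crossForm_nil_self_add_le hT L hf hg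
  | succ d ih =>
    obtain ⟨C, hC, h⟩ := ih
    -- Two uses of the inequality with one side fewer split off four correlations at the cost `C²`;
    -- Cauchy-Schwarz on the two mixed ones gives the factor `2`.
    refine ⟨2 * C ^ 2, by positivity, fun {X} _ {μ} _ {T} hT Ls hLs f g hf hg => ?_⟩
    obtain ⟨L, Ls, rfl⟩ := List.exists_cons_of_length_eq_add_one hLs
    have hLs' : Ls.length = d + 1 := by simpa using hLs
    have hpt : ∀ a b, gowersForm μ T Ls (corr T a b (fun x => f x + g x) (fun x => f x + g x)) ≤
        C * (C * (gowersForm μ T Ls (corr T a b f f) + gowersForm μ T Ls (corr T a b f g)) +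
          C * (gowersForm μ T Ls (corr T a b g f) + gowersForm μ T Ls (corr T a b g g))) := by
      intro a b
      have e : corr T a b (fun x => f x + g x) (fun x => f x + g x) = fun x =>
          (fun y => corr T a b f f y + corr T a b f g y) x +
            (fun y => corr T a b g f y + corr T a b g g y) x := by
        funext x
        simp only [corr, map_add]
        ring
      have hff := hf.corr hT a b hf
      have hfg := hf.corr hT a b hg
      have hgf := hg.corr hT a b hf
      have hgg := hg.corr hT a b hg
      rw [e]
      refine (h hT Ls hLs' _ _ (hff.add hfg) (hgf.add hgg)).trans ?_
      exact mul_le_mul_of_nonneg_left (add_le_add (h hT Ls hLs' _ _ hff hfg)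
        (h hT Ls hLs' _ _ hgf hgg)) hC.le
    refine (avg_sq_mono L hpt).trans ?_
    have e2 : (1 / (L : ℝ) ^ 2) * ∑ a ∈ Finset.Icc 1 L, ∑ b ∈ Finset.Icc 1 L,
        C * (C * (gowersForm μ T Ls (corr T a b f f) + gowersForm μ T Ls (corr T a b f g)) +
          C * (gowersForm μ T Ls (corr T a b g f) + gowersForm μ T Ls (corr T a b g g))) =
        C ^ 2 * (crossForm μ T L Ls f f + crossForm μ T L Ls f g + crossForm μ T L Ls g f +
          crossForm μ T L Ls g g) := by
      simp only [crossForm, ← Finset.mul_sum, Finset.sum_add_distrib]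
      ring
    rw [e2, gowersForm_cons, gowersForm_cons]
    have h1 := crossForm_le (μ := μ) hT L Ls hf hg
    have h2 := crossForm_le (μ := μ) hT L Ls hg hf
    have h3 : 0 < C ^ 2 := by positivity
    nlinarith

theorem gowersForm_comp_iterate (hT : MeasurePreserving T μ μ) (Ls : List ℕ) (n : ℕ)
    {f : X → ℂ} (hf : BddMeas f) :
    gowersForm μ T Ls (fun x => f (T^[n] x)) = gowersForm μ T Ls f := by
  induction Ls generalizing f with
  | nil => simp only [gowersForm, integral_comp_iterate hT n hf.meas.aestronglyMeasurable]
  | cons L Ls ih =>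
    simp only [gowersForm]
    congr 1
    refine Finset.sum_congr rfl fun a _ => Finset.sum_congr rfl fun b _ => ?_
    rw [← ih (hf.corr hT.measurable a b hf)]
    congr 1
    funext x
    simp only [corr, ← Function.iterate_add_apply, add_comm]

theorem gowersForm_conj (Ls : List ℕ) (f : X → ℂ) :
    gowersForm μ T Ls (fun x => conj (f x)) = gowersForm μ T Ls f := by
  induction Ls generalizing f with
  | nil => simp only [gowersForm, integral_conj, Complex.conj_re]
  | cons L Ls ih =>
    simp only [gowersForm]
    congr 1
    refine Finset.sum_congr rfl fun a _ => Finset.sum_congr rfl fun b _ => ?_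
    rw [← ih (corr T a b f f)]
    congr 1
    funext x
    simp only [corr, map_mul]

/-- By invariance of the form under `T`, only the difference of the two shifts matters; this
translates between boxes and the averages over `h`. -/
theorem gowersForm_corr_add (hT : MeasurePreserving T μ μ) (Ls : List ℕ) (a h : ℕ)
    {f : X → ℂ} (hf : BddMeas f) :
    gowersForm μ T Ls (corr T a (a + h) f f) =
      gowersForm μ T Ls (fun x => f x * conj (f (T^[h] x))) := by
  rw [← gowersForm_comp_iterate hT Ls a (hf.mul (hf.conj.comp (hT.measurable.iterate h)))]
  congr 1
  funext x
  simp only [corr, ← Function.iterate_add_apply, add_comm]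

theorem gowersForm_corr_add' (hT : MeasurePreserving T μ μ) (Ls : List ℕ) (a h : ℕ)
    {f : X → ℂ} (hf : BddMeas f) :
    gowersForm μ T Ls (corr T (a + h) a f f) =
      gowersForm μ T Ls (fun x => f x * conj (f (T^[h] x))) := by
  rw [← gowersForm_corr_add hT Ls a h hf, ← gowersForm_conj]
  congr 1
  funext x
  simp only [corr, map_mul, Complex.conj_conj, mul_comm]

/-- Each `h ≤ H` is the difference of the `H` pairs `(a, a + h)` with `a ≤ H`, all lying in the box
of side `2H`. Positivity discards the other pairs, and the area `4H²` of the box gives the constant.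
A general `s` serves both `0 ≤ κ < N` and `1 ≤ h ≤ ⌊√N⌋`. -/
theorem sum_gowersForm_le (hT : MeasurePreserving T μ μ) [IsFiniteMeasure μ] {Ls : List ℕ}
    (hLs : Ls ≠ []) {H : ℕ} (hH : 1 ≤ H) {s : Finset ℕ} (hs : s ⊆ Finset.range (H + 1))
    {f : X → ℂ} (hf : BddMeas f) :
    (1 / (H : ℝ)) * ∑ h ∈ s, gowersForm μ T Ls (fun x => f x * conj (f (T^[h] x))) ≤
      4 * gowersForm μ T (2 * H :: Ls) f := by
  have hH' : (0 : ℝ) < H := by exact_mod_cast hH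
  set ψ : ℕ → ℝ := fun h => gowersForm μ T Ls (fun x => f x * conj (f (T^[h] x))) with hψ
  have hnn : ∀ a b, 0 ≤ gowersForm μ T Ls (corr T a b f f) := fun a b =>
    gowersForm_nonneg hT.measurable hLs (hf.corr hT.measurable a b hf)
  have hin : ∀ a ∈ Finset.Icc 1 H, ∑ h ∈ s, ψ h ≤
      ∑ b ∈ Finset.Icc 1 (2 * H), gowersForm μ T Ls (corr T a b f f) := by
    intro a ha
    have ha' := Finset.mem_Icc.1 ha
    calc ∑ h ∈ s, ψ h = ∑ h ∈ s, gowersForm μ T Ls (corr T a (a + h) f f) :=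
          Finset.sum_congr rfl fun h _ => (gowersForm_corr_add hT Ls a h hf).symm
      _ = ∑ b ∈ s.image (a + ·), gowersForm μ T Ls (corr T a b f f) :=
          (Finset.sum_image (f := fun b => gowersForm μ T Ls (corr T a b f f))
            fun x _ y _ hxy => Nat.add_left_cancel hxy).symm
      _ ≤ _ := by
          refine Finset.sum_le_sum_of_subset_of_nonneg ?_ fun b _ _ => hnn a b
          intro b hb
          obtain ⟨h, hh, rfl⟩ := Finset.mem_image.1 hb
          have := Finset.mem_range.1 (hs hh)
          simp only [Finset.mem_Icc]
          omega
  have h2 : (H : ℝ) * ∑ h ∈ s, ψ h ≤ ∑ a ∈ Finset.Icc 1 (2 * H), ∑ b ∈ Finset.Icc 1 (2 * H),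
      gowersForm μ T Ls (corr T a b f f) := by
    calc (H : ℝ) * ∑ h ∈ s, ψ h = ∑ a ∈ Finset.Icc 1 H, ∑ h ∈ s, ψ h := by simp
      _ ≤ ∑ a ∈ Finset.Icc 1 H, ∑ b ∈ Finset.Icc 1 (2 * H),
          gowersForm μ T Ls (corr T a b f f) := Finset.sum_le_sum hin
      _ ≤ _ := Finset.sum_le_sum_of_subset_of_nonneg
          (Finset.Icc_subset_Icc le_rfl (by omega))
          fun a _ _ => Finset.sum_nonneg fun b _ => hnn a b
  simp only [gowersForm]
  push_cast
  calc (1 / (H : ℝ)) * ∑ h ∈ s, ψ h = (1 / (H : ℝ) ^ 2) * (H * ∑ h ∈ s, ψ h) := by field_simp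
    _ ≤ (1 / (H : ℝ) ^ 2) * _ := mul_le_mul_of_nonneg_left h2 (by positivity)
    _ = _ := by field_simp; ring

/-- Converse of `sum_gowersForm_le`: for fixed `a`, each positive difference comes from at most one
`b` on either side of `a`, and `b = a` gives the diagonal term. Positivity is a hypothesis so that
the empty list is allowed, as the recurrence argument requires. -/
theorem gowersForm_cons_le (hT : MeasurePreserving T μ μ) [IsFiniteMeasure μ] {Ls : List ℕ}
    {l : ℕ} (hl : 1 ≤ l) {f : X → ℂ} (hf : BddMeas f)
    (hψ : ∀ h : ℕ, 0 ≤ gowersForm μ T Ls (fun x => f x * conj (f (T^[h] x)))) :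
    gowersForm μ T (l :: Ls) f ≤ (1 / (l : ℝ)) * gowersForm μ T Ls (fun x => f x * conj (f x)) +
      2 * ((1 / (l : ℝ)) * ∑ h ∈ Finset.Icc 1 l,
        gowersForm μ T Ls (fun x => f x * conj (f (T^[h] x)))) := by
  have hl' : (0 : ℝ) < l := by exact_mod_cast hl
  set ψ : ℕ → ℝ := fun h => gowersForm μ T Ls (fun x => f x * conj (f (T^[h] x))) with hψd
  have hψ0 : gowersForm μ T Ls (fun x => f x * conj (f x)) = ψ 0 := by simp [hψd]
  have hin : ∀ a ∈ Finset.Icc 1 l, ∑ b ∈ Finset.Icc 1 l, gowersForm μ T Ls (corr T a b f f) ≤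
      ψ 0 + 2 * ∑ h ∈ Finset.Icc 1 l, ψ h := by
    intro a ha
    have ha' := Finset.mem_Icc.1 ha
    have e1 : ∑ b ∈ Finset.Icc 1 l, gowersForm μ T Ls (corr T a b f f) =
        ∑ b ∈ Finset.Icc 1 l with b < a, ψ (a - b) + ∑ b ∈ Finset.Icc 1 l with ¬ b < a, ψ (b - a) := by
      rw [← Finset.sum_filter_add_sum_filter_not _ (fun b => b < a)]
      congr 1
      · refine Finset.sum_congr rfl fun b hb => ?_
        have := (Finset.mem_filter.1 hb).2
        have h := gowersForm_corr_add' hT Ls b (a - b) hf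
        rwa [Nat.add_sub_cancel' this.le] at h
      · refine Finset.sum_congr rfl fun b hb => ?_
        have := (Finset.mem_filter.1 hb).2
        have h := gowersForm_corr_add hT Ls a (b - a) hf
        rwa [Nat.add_sub_cancel' (not_lt.1 this)] at h
    have e2 : ∑ b ∈ Finset.Icc 1 l with b < a, ψ (a - b) ≤ ∑ h ∈ Finset.Icc 1 l, ψ h := by
      rw [← Finset.sum_image (g := fun b => a - b) (f := ψ)]
      · refine Finset.sum_le_sum_of_subset_of_nonneg (fun h hh => ?_) fun h _ _ => hψ h
        obtain ⟨b, hb, rfl⟩ := Finset.mem_image.1 hh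
        simp only [Finset.mem_filter, Finset.mem_Icc] at hb ⊢
        omega
      · intro x hx y hy hxy
        simp only [Finset.coe_filter, Set.mem_ofPred_eq] at hx hy hxy
        omega
    have e3 : ∑ b ∈ Finset.Icc 1 l with ¬ b < a, ψ (b - a) ≤
        ψ 0 + ∑ h ∈ Finset.Icc 1 l, ψ h := by
      rw [← Finset.sum_image (g := fun b => b - a) (f := ψ),
        ← Finset.sum_insert (s := Finset.Icc 1 l) (a := 0) (by simp)]
      · refine Finset.sum_le_sum_of_subset_of_nonneg (fun h hh => ?_) fun h _ _ => hψ h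
        obtain ⟨b, hb, rfl⟩ := Finset.mem_image.1 hh
        simp only [Finset.mem_filter, Finset.mem_Icc, Finset.mem_insert] at hb ⊢
        omega
      · intro x hx y hy hxy
        simp only [Finset.coe_filter, Set.mem_ofPred_eq] at hx hy hxy
        omega
    linarith
  rw [hψ0]
  calc gowersForm μ T (l :: Ls) f ≤ (1 / (l : ℝ) ^ 2) *
        ∑ a ∈ Finset.Icc 1 l, (ψ 0 + 2 * ∑ h ∈ Finset.Icc 1 l, ψ h) :=
        mul_le_mul_of_nonneg_left (Finset.sum_le_sum hin) (by positivity)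
    _ = _ := by
        simp only [Finset.sum_const, Nat.card_Icc, Nat.add_sub_cancel, nsmul_eq_mul]
        field_simp

end Forms

/-! ### Van der Corput expansion and Parseval on roots of unity -/

section ExponentialSums

/-- Expand the square, keep the pairs `n ≤ m` (the diagonal is counted twice, which only helps), and
group them by `κ = m - n`. -/
theorem norm_sum_sq_le_two_mul (v : ℕ → ℂ) (N : ℕ) :
    ‖∑ n ∈ Finset.Icc 1 N, v n‖ ^ 2 ≤
      2 * ∑ κ ∈ Finset.range N, ‖∑ a ∈ Finset.Icc 1 (N - κ), v a * conj (v (a + κ))‖ := by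
  have h1 : ‖∑ n ∈ Finset.Icc 1 N, v n‖ ^ 2 ≤
      2 * (∑ m ∈ Finset.Icc 1 N, ∑ n ∈ Finset.Icc 1 m, v n * conj (v m)).re := by
    induction N with
    | zero => simp
    | succ N ih =>
      rw [Finset.sum_Icc_succ_top (by omega), Finset.sum_Icc_succ_top (by omega),
        Finset.sum_Icc_succ_top (by omega), ← Finset.sum_mul]
      set s := ∑ n ∈ Finset.Icc 1 N, v n
      set w := v (N + 1)
      have e : ‖s + w‖ ^ 2 = ‖s‖ ^ 2 + 2 * (s * conj w).re + ‖w‖ ^ 2 := by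
        rw [← Complex.normSq_eq_norm_sq, ← Complex.normSq_eq_norm_sq, ← Complex.normSq_eq_norm_sq,
          Complex.normSq_add]
        ring
      have e2 : (w * conj w).re = ‖w‖ ^ 2 := by
        rw [Complex.mul_conj, Complex.ofReal_re, Complex.normSq_eq_norm_sq]
      rw [e, Complex.add_re, Complex.add_re, e2]
      nlinarith [sq_nonneg ‖w‖]
  have h2 : ∑ m ∈ Finset.Icc 1 N, ∑ n ∈ Finset.Icc 1 m, v n * conj (v m) =
      ∑ κ ∈ Finset.range N, ∑ a ∈ Finset.Icc 1 (N - κ), v a * conj (v (a + κ)) := by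
    rw [Finset.sum_sigma', Finset.sum_sigma']
    refine Finset.sum_nbij' (fun p => ⟨p.1 - p.2, p.2⟩) (fun p => ⟨p.2 + p.1, p.2⟩) ?_ ?_ ?_ ?_ ?_
    · rintro ⟨m, n⟩ h
      simp only [Finset.mem_sigma, Finset.mem_Icc, Finset.mem_range] at h ⊢
      omega
    · rintro ⟨m, n⟩ h
      simp only [Finset.mem_sigma, Finset.mem_Icc, Finset.mem_range] at h ⊢
      omega
    · rintro ⟨m, n⟩ h
      simp only [Finset.mem_sigma, Finset.mem_Icc] at h
      simp only [Nat.add_sub_cancel' h.2.2]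
    · rintro ⟨m, n⟩ h
      simp
    · rintro ⟨m, n⟩ h
      simp only [Finset.mem_sigma, Finset.mem_Icc] at h
      simp only [Nat.add_sub_cancel' h.2.2]
  rw [h2] at h1
  refine h1.trans (mul_le_mul_of_nonneg_left ?_ zero_le_two)
  exact (Complex.re_le_norm _).trans (norm_sum_le _ _)

theorem sum_exp_mul_conj_exp {R p q : ℕ} (hp : p < R) (hq : q < R) :
    ∑ j ∈ Finset.range R, Complex.exp (2 * Real.pi * Complex.I * p * ((j / R : ℝ) : ℂ)) *
      conj (Complex.exp (2 * Real.pi * Complex.I * q * ((j / R : ℝ) : ℂ))) =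
        if p = q then (R : ℂ) else 0 := by
  have hR : R ≠ 0 := by omega
  have hRc : (R : ℂ) ≠ 0 := by exact_mod_cast hR
  set ζ := Complex.exp (2 * Real.pi * Complex.I / R) with hζ
  have hprim : IsPrimitiveRoot ζ R := Complex.isPrimitiveRoot_exp R hR
  have hpow : ∀ p j : ℕ, Complex.exp (2 * Real.pi * Complex.I * p * ((j / R : ℝ) : ℂ)) =
      (ζ ^ p) ^ j := by
    intro p j
    rw [hζ, ← Complex.exp_nat_mul, ← Complex.exp_nat_mul]
    congr 1
    push_cast
    field_simp
  have hnorm : ‖ζ ^ q‖ = 1 := by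
    rw [norm_pow, hprim.norm'_eq_one hR, one_pow]
  have hne : ζ ^ q ≠ 0 := norm_ne_zero_iff.1 (by rw [hnorm]; exact one_ne_zero)
  have hconj : conj (ζ ^ q) = (ζ ^ q)⁻¹ := by
    rw [Complex.inv_def, Complex.normSq_eq_norm_sq, hnorm]
    simp
  have hterm : ∀ j ∈ Finset.range R,
      Complex.exp (2 * Real.pi * Complex.I * p * ((j / R : ℝ) : ℂ)) *
        conj (Complex.exp (2 * Real.pi * Complex.I * q * ((j / R : ℝ) : ℂ))) =
          (ζ ^ p * (ζ ^ q)⁻¹) ^ j := by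
    intro j _
    rw [hpow, hpow, map_pow, hconj, mul_pow]
  rw [Finset.sum_congr rfl hterm]
  split_ifs with h
  · subst h
    simp [mul_inv_cancel₀ hne]
  · have h1 : ζ ^ p * (ζ ^ q)⁻¹ ≠ 1 := fun h1 => h (hprim.pow_inj hp hq
      ((mul_inv_eq_one₀ hne).1 h1))
    rw [geom_sum_eq h1, mul_pow, inv_pow, ← pow_mul, ← pow_mul, mul_comm p, mul_comm q, pow_mul,
      pow_mul, hprim.pow_eq_one]
    simp

/-- Parseval's identity for exponential sums on the `R`-th roots of unity. -/
theorem sum_norm_sq_exp_sum {R : ℕ} {s : Finset ℕ} (hs : ∀ p ∈ s, p < R) (a : ℕ → ℂ) :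
    ∑ j ∈ Finset.range R, ‖∑ p ∈ s,
      Complex.exp (2 * Real.pi * Complex.I * p * ((j / R : ℝ) : ℂ)) * a p‖ ^ 2 =
        R * ∑ p ∈ s, ‖a p‖ ^ 2 := by
  have key : ∑ j ∈ Finset.range R, (∑ p ∈ s,
      Complex.exp (2 * Real.pi * Complex.I * p * ((j / R : ℝ) : ℂ)) * a p) * conj (∑ q ∈ s,
        Complex.exp (2 * Real.pi * Complex.I * q * ((j / R : ℝ) : ℂ)) * a q) =
      R * ∑ p ∈ s, a p * conj (a p) := by
    simp only [map_sum, Finset.sum_mul_sum, map_mul]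
    rw [Finset.sum_comm, Finset.mul_sum]
    refine Finset.sum_congr rfl fun p hp => ?_
    rw [Finset.sum_comm]
    have : ∀ q ∈ s, ∑ j ∈ Finset.range R,
        Complex.exp (2 * Real.pi * Complex.I * p * ((j / R : ℝ) : ℂ)) * a p *
          (conj (Complex.exp (2 * Real.pi * Complex.I * q * ((j / R : ℝ) : ℂ))) * conj (a q)) =
        if p = q then R * (a p * conj (a q)) else 0 := by
      intro q hq
      rw [← ite_zero_mul, ← sum_exp_mul_conj_exp (hs p hp) (hs q hq), Finset.sum_mul]
      exact Finset.sum_congr rfl fun j _ => by ring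
    rw [Finset.sum_congr rfl this, Finset.sum_ite_eq, if_pos hp]
  simp only [Complex.mul_conj, Complex.normSq_eq_norm_sq] at key
  exact_mod_cast key

/-- The correlations of a finite sequence with another one are bounded in `ℓ²` by the supremum of
its exponential sums. -/
theorem sum_norm_sq_correlation_le (M : ℕ) (w v : ℕ → ℂ) {B : ℝ}
    (hw : ∀ t : ℝ, ‖∑ c ∈ Finset.Icc 1 M,
      Complex.exp (2 * Real.pi * Complex.I * c * t) * w c‖ ≤ B) :
    ∑ b ∈ Finset.Icc 1 M, ‖∑ c ∈ Finset.Icc 1 M, w c * conj (v (b + c))‖ ^ 2 ≤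
      B ^ 2 * ∑ m ∈ Finset.Icc 1 (2 * M), ‖v m‖ ^ 2 := by
  -- All frequencies `b + c` and `m` are at most `2M < R`, so the orthogonality on `R`-th roots of
  -- unity has no wraparound.
  set R := 2 * M + 1 with hR
  set z : ℕ → ℂ := fun b => ∑ c ∈ Finset.Icc 1 M, w c * conj (v (b + c)) with hz
  set Z := ∑ b ∈ Finset.Icc 1 M, ‖z b‖ ^ 2 with hZ
  set V := ∑ m ∈ Finset.Icc 1 (2 * M), ‖v m‖ ^ 2 with hV
  set e : ℕ → ℕ → ℂ := fun p j => Complex.exp (2 * Real.pi * Complex.I * p * ((j / R : ℝ) : ℂ))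
    with he
  set P : ℕ → ℂ := fun j => ∑ c ∈ Finset.Icc 1 M, e c j * w c
  set Q : ℕ → ℂ := fun j => ∑ b ∈ Finset.Icc 1 M, e b j * conj (z b)
  set U : ℕ → ℂ := fun j => ∑ m ∈ Finset.Icc 1 (2 * M), e m j * v m
  have hadd : ∀ b c j, e b j * e c j = e (b + c) j := by
    intro b c j
    simp only [he]
    rw [← Complex.exp_add]
    congr 1
    push_cast
    ring
  have hQ : ∑ j ∈ Finset.range R, ‖Q j‖ ^ 2 = R * Z := by
    have := sum_norm_sq_exp_sum (R := R) (s := Finset.Icc 1 M)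
      (fun p hp => by have := Finset.mem_Icc.1 hp; omega) (fun b => conj (z b))
    simpa only [RCLike.norm_conj] using this
  have hU : ∑ j ∈ Finset.range R, ‖U j‖ ^ 2 = R * V :=
    sum_norm_sq_exp_sum (fun p hp => by have := Finset.mem_Icc.1 hp; omega) v
  -- Duality: pairing with `conj (z b)` turns the sum of squares `Z` into a trilinear sum. There `P`
  -- is bounded by `B`, while Parseval handles `Q` and `U`.
  have hmain : ∑ j ∈ Finset.range R, P j * Q j * conj (U j) = ((R * Z : ℝ) : ℂ) := by
    have h1 : ∀ j, P j * Q j * conj (U j) = ∑ b ∈ Finset.Icc 1 M, ∑ c ∈ Finset.Icc 1 M,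
        ∑ m ∈ Finset.Icc 1 (2 * M), (conj (z b) * w c * conj (v m)) *
          (e (b + c) j * conj (e m j)) := by
      intro j
      rw [mul_comm (P j)]
      simp only [P, Q, U, map_sum, map_mul]
      rw [Finset.sum_mul_sum, Finset.sum_mul]
      refine Finset.sum_congr rfl fun b _ => ?_
      rw [Finset.sum_mul_sum]
      refine Finset.sum_congr rfl fun c _ => Finset.sum_congr rfl fun m _ => ?_
      rw [← hadd]
      ring
    simp only [h1]
    rw [Finset.sum_comm, hZ]
    push_cast
    rw [Finset.mul_sum]
    refine Finset.sum_congr rfl fun b hb => ?_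
    rw [Finset.sum_comm, ← Complex.ofReal_pow, ← Complex.normSq_eq_norm_sq, Complex.normSq_eq_conj_mul_self]
    conv_rhs => rw [hz]
    simp only
    rw [Finset.mul_sum, Finset.mul_sum]
    refine Finset.sum_congr rfl fun c hc => ?_
    have hb' := Finset.mem_Icc.1 hb
    have hc' := Finset.mem_Icc.1 hc
    rw [Finset.sum_comm]
    have : ∀ m ∈ Finset.Icc 1 (2 * M), ∑ j ∈ Finset.range R,
        (conj (z b) * w c * conj (v m)) * (e (b + c) j * conj (e m j)) =
          if b + c = m then R * (conj (z b) * (w c * conj (v m))) else 0 := by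
      intro m hm
      have hm' := Finset.mem_Icc.1 hm
      rw [← Finset.mul_sum, sum_exp_mul_conj_exp (by omega) (by omega)]
      split_ifs <;> ring
    rw [Finset.sum_congr rfl this, Finset.sum_ite_eq, if_pos (by simp only [Finset.mem_Icc]; omega)]
  have hZ0 : 0 ≤ Z := Finset.sum_nonneg fun _ _ => sq_nonneg _
  have hV0 : 0 ≤ V := Finset.sum_nonneg fun _ _ => sq_nonneg _
  have hR0 : (0 : ℝ) < R := by rw [hR]; positivity
  have hle : R * Z ≤ B * ∑ j ∈ Finset.range R, ‖Q j‖ * ‖U j‖ := by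
    have : R * Z = ‖((R * Z : ℝ) : ℂ)‖ := by
      rw [Complex.norm_real, Real.norm_of_nonneg (by positivity)]
    rw [this, ← hmain, Finset.mul_sum]
    refine norm_sum_le_of_le _ fun j _ => ?_
    rw [norm_mul, norm_mul, RCLike.norm_conj, mul_assoc]
    exact mul_le_mul_of_nonneg_right (hw _) (by positivity)
  have hcs := Finset.sum_mul_sq_le_sq_mul_sq (Finset.range R) (fun j => ‖Q j‖) (fun j => ‖U j‖)
  rw [hQ, hU] at hcs
  rcases hZ0.eq_or_lt with h0 | h0
  · rw [← h0]; positivity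
  · have h2 : (R * Z) ^ 2 ≤ B ^ 2 * ((R * Z) * (R * V)) := by
      calc (R * Z) ^ 2 ≤ (B * ∑ j ∈ Finset.range R, ‖Q j‖ * ‖U j‖) ^ 2 :=
            pow_le_pow_left₀ (by positivity) hle 2
        _ = B ^ 2 * (∑ j ∈ Finset.range R, ‖Q j‖ * ‖U j‖) ^ 2 := by ring
        _ ≤ _ := mul_le_mul_of_nonneg_left hcs (sq_nonneg _)
    have h3 : (R ^ 2 * Z) * Z ≤ (R ^ 2 * Z) * (B ^ 2 * V) := by nlinarith
    exact le_of_mul_le_mul_left h3 (by positivity)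

end ExponentialSums

/-! ### First-order averages against forms with two sides -/

section WienerWintner

variable {X : Type*} [MeasurableSpace X] {μ : Measure X} {T : X → X}

/-- The phases of `v a * conj (v (a + κ))` combine to a factor of modulus one that depends only on
`κ` and `t`. The bound on correlations is therefore uniform in `t`; Cauchy-Schwarz over `κ` yields
the fourth power. -/
theorem wienerSup_pow_four_le {Y : Type*} {S : Y → Y} {N : ℕ} (hN : 1 ≤ N) (g : Y → ℂ) (x : Y) :
    wienerSup S N g x ^ 4 ≤ (4 / (N : ℝ)) * ∑ κ ∈ Finset.range N,
      ‖(1 / (N : ℂ)) * ∑ a ∈ Finset.Icc 1 (N - κ),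
        (fun y => g y * conj (g (S^[κ] y))) (S^[a] x)‖ ^ 2 := by
  have hN' : (0 : ℝ) < N := by exact_mod_cast hN
  have hNn : ‖(1 / (N : ℂ))‖ = 1 / N := by simp
  set D : ℕ → ℝ := fun κ => ‖(1 / (N : ℂ)) * ∑ a ∈ Finset.Icc 1 (N - κ),
        (fun y => g y * conj (g (S^[κ] y))) (S^[a] x)‖ with hD
  set K := (4 / (N : ℝ)) * ∑ κ ∈ Finset.range N, D κ ^ 2 with hK
  have hK0 : 0 ≤ K := mul_nonneg (by positivity) (Finset.sum_nonneg fun _ _ => sq_nonneg _)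
  have hle : wienerSup S N g x ≤ √√K := by
    refine ciSup_le fun t => Real.le_sqrt_of_sq_le (Real.le_sqrt_of_sq_le ?_)
    set v : ℕ → ℂ := fun n => Complex.exp (2 * Real.pi * Complex.I * n * t) * g (S^[n] x) with hv
    have hc : ∀ κ, ‖∑ a ∈ Finset.Icc 1 (N - κ), v a * conj (v (a + κ))‖ = N * D κ := by
      intro κ
      have e : ∀ a, v a * conj (v (a + κ)) =
          conj (Complex.exp (2 * Real.pi * Complex.I * κ * t)) *
            (g (S^[a] x) * conj (g (S^[κ] (S^[a] x)))) := by
        intro a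
        have h1 : Complex.exp (2 * Real.pi * Complex.I * (a + κ : ℕ) * t) =
            Complex.exp (2 * Real.pi * Complex.I * a * t) *
              Complex.exp (2 * Real.pi * Complex.I * κ * t) := by
          rw [← Complex.exp_add]
          congr 1
          push_cast
          ring
        have h2 : Complex.exp (2 * Real.pi * Complex.I * a * t) *
            conj (Complex.exp (2 * Real.pi * Complex.I * a * t)) = 1 := by
          rw [Complex.mul_conj, Complex.normSq_eq_norm_sq, norm_exp_two_pi]
          simp
        simp only [hv, h1, map_mul, ← Function.iterate_add_apply, add_comm κ a]
        linear_combination (conj (Complex.exp (2 * Real.pi * Complex.I * κ * t)) *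
            (g (S^[a] x) * conj (g (S^[a + κ] x)))) * h2
      simp only [e, ← Finset.mul_sum]
      rw [norm_mul, RCLike.norm_conj, norm_exp_two_pi, one_mul, hD]
      simp only
      rw [norm_mul, hNn]
      field_simp
    have h1 := norm_sum_sq_le_two_mul v N
    simp only [hc, ← Finset.mul_sum] at h1
    have h2 : ‖(1 / (N : ℂ)) * ∑ n ∈ Finset.Icc 1 N, v n‖ ^ 2 ≤
        (2 / N) * ∑ κ ∈ Finset.range N, D κ := by
      rw [norm_mul, hNn, mul_pow]
      calc (1 / (N : ℝ)) ^ 2 * ‖∑ n ∈ Finset.Icc 1 N, v n‖ ^ 2 ≤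
            (1 / (N : ℝ)) ^ 2 * (2 * (N * ∑ κ ∈ Finset.range N, D κ)) :=
            mul_le_mul_of_nonneg_left h1 (by positivity)
        _ = _ := by field_simp
    have h3 : (∑ κ ∈ Finset.range N, D κ) ^ 2 ≤ N * ∑ κ ∈ Finset.range N, D κ ^ 2 := by
      simpa using sq_sum_le_card_mul_sum_sq (s := Finset.range N) (f := D)
    calc (‖(1 / (N : ℂ)) * ∑ n ∈ Finset.Icc 1 N, v n‖ ^ 2) ^ 2 ≤
          ((2 / N) * ∑ κ ∈ Finset.range N, D κ) ^ 2 := pow_le_pow_left₀ (by positivity) h2 2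
      _ = (2 / (N : ℝ)) ^ 2 * (∑ κ ∈ Finset.range N, D κ) ^ 2 := mul_pow _ _ _
      _ ≤ (2 / (N : ℝ)) ^ 2 * (N * ∑ κ ∈ Finset.range N, D κ ^ 2) :=
          mul_le_mul_of_nonneg_left h3 (by positivity)
      _ = K := by rw [hK]; field_simp; ring
  calc wienerSup S N g x ^ 4 ≤ √√K ^ 4 := pow_le_pow_left₀ (wienerSup_nonneg _ _ _) hle 4
    _ = (√√K ^ 2) ^ 2 := by ring
    _ = K := by rw [Real.sq_sqrt (Real.sqrt_nonneg _), Real.sq_sqrt hK0]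

theorem wwAverage_one_pow_six_le [IsProbabilityMeasure μ] (hT : MeasurePreserving T μ μ)
    {N l : ℕ} (hN : 1 ≤ N) (hl : 1 ≤ l) {g : X → ℂ} (hg : UnitMeas g) :
    wwAverage μ T 1 N g ^ 6 ≤ 8 * ((1 / (N : ℝ)) * ∑ κ ∈ Finset.range N,
      gowersForm μ T [l] (fun x => g x * conj (g (T^[κ] x)))) + 32 * ((l : ℝ) / N) ^ 2 := by
  have hN' : (0 : ℝ) < N := by exact_mod_cast hN
  have hTm := hT.measurable
  have hG : ∀ κ, UnitMeas (fun x => g x * conj (g (T^[κ] x))) := fun κ =>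
    hg.mul_conj_comp (hTm.iterate κ)
  have hint2 := integrable_wienerSup_pow (μ := μ) hTm hg.bddMeas N 2
  have hint4 := integrable_wienerSup_pow (μ := μ) hTm hg.bddMeas N 4
  set c := ∫ x, wienerSup T N g x ^ 2 ∂μ with hc
  have h1 : c ^ 2 ≤ ∫ x, wienerSup T N g x ^ 4 ∂μ := by
    -- Integrating `(S² - c)² ≥ 0` with `c = ∫ S²` gives `c² ≤ ∫ S⁴`.
    have h : ∫ x, (2 * c * wienerSup T N g x ^ 2 - c ^ 2) ∂μ ≤ ∫ x, wienerSup T N g x ^ 4 ∂μ := by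
      refine integral_mono ((hint2.const_mul _).sub (integrable_const _)) hint4 fun x => ?_
      simp only
      nlinarith [sq_nonneg (wienerSup T N g x ^ 2 - c)]
    rw [integral_sub (hint2.const_mul _) (integrable_const _), integral_const_mul, ← hc] at h
    simp only [integral_const, probReal_univ, one_smul] at h
    nlinarith
  have hbd : ∀ κ, BddMeas (fun x => (1 / (N : ℂ)) * ∑ a ∈ Finset.Icc 1 (N - κ),
      (fun y => g y * conj (g (T^[κ] y))) (T^[a] x)) := fun κ =>
    BddMeas.const_mul (BddMeas.sum fun a _ => (hG κ).bddMeas.comp (hTm.iterate a)) _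
  have h2 : ∫ x, wienerSup T N g x ^ 4 ∂μ ≤ (4 / (N : ℝ)) * ∑ κ ∈ Finset.range N,
      ∫ x, ‖(1 / (N : ℂ)) * ∑ a ∈ Finset.Icc 1 (N - κ),
        (fun y => g y * conj (g (T^[κ] y))) (T^[a] x)‖ ^ 2 ∂μ := by
    rw [← integral_finsetSum _ fun κ _ => (hbd κ).integrable_norm_sq, ← integral_const_mul]
    refine integral_mono hint4 ((integrable_finsetSum _ fun κ _ =>
      (hbd κ).integrable_norm_sq).const_mul _) fun x => ?_
    exact wienerSup_pow_four_le hN g x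
  have h3 : ∑ κ ∈ Finset.range N, ∫ x, ‖(1 / (N : ℂ)) * ∑ a ∈ Finset.Icc 1 (N - κ),
        (fun y => g y * conj (g (T^[κ] y))) (T^[a] x)‖ ^ 2 ∂μ ≤ ∑ κ ∈ Finset.range N,
      (2 * gowersForm μ T [l] (fun x => g x * conj (g (T^[κ] x))) + 8 * ((l : ℝ) / N) ^ 2) := by
    refine Finset.sum_le_sum fun κ _ => ?_
    rw [gowersForm_cons, crossForm_nil_self hTm l (hG κ).bddMeas]
    exact integral_norm_sum_sq_le hT (hG κ) (Nat.sub_le _ _) hN hl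
  calc wwAverage μ T 1 N g ^ 6 = (wwAverage μ T 1 N g ^ 3) ^ 2 := by ring
    _ = c ^ 2 := by rw [wwAverage_one_pow_three hTm hg.bddMeas]
    _ ≤ _ := h1.trans (h2.trans (mul_le_mul_of_nonneg_left h3 (by positivity)))
    _ = _ := by
      rw [Finset.sum_add_distrib, ← Finset.mul_sum]
      simp only [Finset.sum_const, Finset.card_range, nsmul_eq_mul]
      field_simp
      ring

/-- For fixed `a` and `x`, the averages over `b` are correlations of the orbit segment starting at
`T^a x` with the one starting at `x`. The former has exponential sums at most `M · S`, with `S` the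
Wiener supremum at `T^a x`; the latter has energy at most `2M`. Invariance of `μ` removes `a`. -/
theorem gowersForm_pair_le [IsProbabilityMeasure μ] (hT : MeasurePreserving T μ μ)
    {M : ℕ} (hM : 1 ≤ M) {g : X → ℂ} (hg : UnitMeas g) :
    gowersForm μ T [M, M] g ≤ 2 * wwAverage μ T 1 M g ^ 3 := by
  have hM' : (0 : ℝ) < M := by exact_mod_cast hM
  have hMn : ‖(1 / (M : ℂ))‖ = 1 / M := by simp
  have hTm := hT.measurable
  have hbd : ∀ a b, BddMeas (orbitAvg T M (corr T a b g g)) := fun a b =>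
    (hg.bddMeas.corr hTm a b hg.bddMeas).orbitAvg hTm M
  have hint2 := integrable_wienerSup_pow (μ := μ) hTm hg.bddMeas M 2
  have hintT : ∀ a, Integrable (fun x => wienerSup T M g (T^[a] x) ^ 2) μ := fun a =>
    ((hT.iterate a).integrable_comp hint2.aestronglyMeasurable).2 hint2
  have hpt : ∀ a x, ∑ b ∈ Finset.Icc 1 M, ‖orbitAvg T M (corr T a b g g) x‖ ^ 2 ≤
      2 * M * wienerSup T M g (T^[a] x) ^ 2 := by
    intro a x
    set w : ℕ → ℂ := fun c => g (T^[c] (T^[a] x)) with hw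
    set v : ℕ → ℂ := fun m => g (T^[m] x) with hv
    set S := wienerSup T M g (T^[a] x)
    have hS0 : 0 ≤ S := wienerSup_nonneg _ _ _
    have hwS : ∀ t : ℝ, ‖∑ c ∈ Finset.Icc 1 M,
        Complex.exp (2 * Real.pi * Complex.I * c * t) * w c‖ ≤ M * S := by
      intro t
      have h := le_wienerSup (T := T) hg.bddMeas M (T^[a] x) t
      rw [norm_mul, hMn, one_div, inv_mul_le_iff₀ hM'] at h
      exact h
    have h := sum_norm_sq_correlation_le M w v hwS
    have hv1 : ∑ m ∈ Finset.Icc 1 (2 * M), ‖v m‖ ^ 2 ≤ 2 * M := by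
      refine (Finset.sum_le_card_nsmul _ _ 1 fun m _ =>
        pow_le_one₀ (norm_nonneg _) (hg.le_one _)).trans ?_
      simp
    have e : ∀ b, orbitAvg T M (corr T a b g g) x = (1 / (M : ℂ)) * ∑ c ∈ Finset.Icc 1 M,
        w c * conj (v (b + c)) := by
      intro b
      simp only [orbitAvg, corr, hw, hv, ← Function.iterate_add_apply]
      simp only [add_comm]
    simp only [e, norm_mul, hMn, mul_pow]
    rw [← Finset.mul_sum]
    calc (1 / (M : ℝ)) ^ 2 * _ ≤ (1 / (M : ℝ)) ^ 2 * ((M * S) ^ 2 * (2 * M)) :=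
          mul_le_mul_of_nonneg_left (h.trans (mul_le_mul_of_nonneg_left hv1 (sq_nonneg _)))
            (by positivity)
      _ = _ := by field_simp
  have hb : ∀ a ∈ Finset.Icc 1 M, ∑ b ∈ Finset.Icc 1 M, gowersForm μ T [M] (corr T a b g g) ≤
      2 * M * ∫ x, wienerSup T M g x ^ 2 ∂μ := by
    intro a _
    have e : ∀ b, gowersForm μ T [M] (corr T a b g g) =
        ∫ x, ‖orbitAvg T M (corr T a b g g) x‖ ^ 2 ∂μ := fun b => by
      rw [gowersForm_cons, crossForm_nil_self hTm M (hg.bddMeas.corr hTm a b hg.bddMeas)]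
    simp only [e]
    rw [← integral_finsetSum _ fun b _ => (hbd a b).integrable_norm_sq,
      ← integral_comp_iterate hT a hint2.aestronglyMeasurable, ← integral_const_mul]
    exact integral_mono (integrable_finsetSum _ fun b _ => (hbd a b).integrable_norm_sq)
      ((hintT a).const_mul _) fun x => hpt a x
  rw [wwAverage_one_pow_three hTm hg.bddMeas]
  calc gowersForm μ T [M, M] g ≤ (1 / (M : ℝ) ^ 2) * ∑ a ∈ Finset.Icc 1 M,
        2 * M * ∫ x, wienerSup T M g x ^ 2 ∂μ :=
        mul_le_mul_of_nonneg_left (Finset.sum_le_sum hb) (by positivity)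
    _ = _ := by
        simp only [Finset.sum_const, Nat.card_Icc, Nat.add_sub_cancel, nsmul_eq_mul]
        field_simp

/-- The supremum of the exponential sums dominates their mean square over the `(N + 1)`-st roots of
unity, which is the energy of the orbit segment. -/
theorem integral_norm_sq_le_wwAverage_one [IsProbabilityMeasure μ] (hT : MeasurePreserving T μ μ)
    {N : ℕ} (hN : 1 ≤ N) {g : X → ℂ} (hg : BddMeas g) :
    ∫ x, ‖g x‖ ^ 2 ∂μ ≤ N * wwAverage μ T 1 N g ^ 3 := by
  have hN' : (0 : ℝ) < N := by exact_mod_cast hN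
  have hNn : ‖(1 / (N : ℂ))‖ = 1 / N := by simp
  have hTm := hT.measurable
  have hint2 := integrable_wienerSup_pow (μ := μ) hTm hg N 2
  have hpt : ∀ x, ∑ n ∈ Finset.Icc 1 N, ‖g (T^[n] x)‖ ^ 2 ≤ N ^ 2 * wienerSup T N g x ^ 2 := by
    intro x
    have h := sum_norm_sq_exp_sum (R := N + 1) (s := Finset.Icc 1 N)
      (fun p hp => by have := Finset.mem_Icc.1 hp; omega) (fun n => g (T^[n] x))
    have h2 : ∀ j ∈ Finset.range (N + 1), ‖∑ n ∈ Finset.Icc 1 N,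
        Complex.exp (2 * Real.pi * Complex.I * n * ((j / (N + 1 : ℕ) : ℝ) : ℂ)) * g (T^[n] x)‖ ^ 2 ≤
          N ^ 2 * wienerSup T N g x ^ 2 := by
      intro j _
      have h := le_wienerSup (T := T) hg N x (j / (N + 1 : ℕ) : ℝ)
      rw [norm_mul, hNn, one_div, inv_mul_le_iff₀ hN'] at h
      rw [← mul_pow]
      exact pow_le_pow_left₀ (norm_nonneg _) h 2
    have h3 := Finset.sum_le_card_nsmul _ _ _ h2
    rw [h, Finset.card_range, nsmul_eq_mul] at h3
    exact le_of_mul_le_mul_left h3 (by positivity)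
  have hi : ∀ n, Integrable (fun x => ‖g (T^[n] x)‖ ^ 2) μ := fun n =>
    (hg.comp (hTm.iterate n)).integrable_norm_sq
  have h := integral_mono (integrable_finsetSum (Finset.Icc 1 N) fun n _ => hi n)
    (hint2.const_mul _) hpt
  rw [integral_finsetSum _ fun n _ => hi n, integral_const_mul] at h
  have hinv : ∀ n, ∫ x, ‖g (T^[n] x)‖ ^ 2 ∂μ = ∫ x, ‖g x‖ ^ 2 ∂μ := fun n =>
    integral_comp_iterate hT n hg.integrable_norm_sq.aestronglyMeasurable
  simp only [hinv, Finset.sum_const, Nat.card_Icc, Nat.add_sub_cancel, nsmul_eq_mul] at h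
  rw [wwAverage_one_pow_three hTm hg]
  refine le_of_mul_le_mul_left ?_ hN'
  linarith

end WienerWintner

/-! ### Comparison of higher-order averages with local Gowers forms -/

section Comparison

variable {X : Type*} [MeasurableSpace X] {μ : Measure X} {T : X → X}

theorem wwAverage_pow_six_le_gowersForm [IsProbabilityMeasure μ] (hT : MeasurePreserving T μ μ)
    {N M : ℕ} (hN : 1 ≤ N) (hM : 1 ≤ M) (k : ℕ) {f : X → ℂ} (hf : UnitMeas f) :
    wwAverage μ T (k + 1) N f ^ 6 ≤
      32 * 4 ^ k * gowersForm μ T (List.replicate k (2 * Nat.sqrt N) ++ [2 * N, M]) f +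
        32 * ((M : ℝ) / N) ^ 2 := by
  induction k generalizing f with
  | zero =>
    refine (wwAverage_one_pow_six_le hT hN hM hf).trans ?_
    have h := sum_gowersForm_le hT (Ls := [M]) (by simp) hN
      (Finset.range_mono (Nat.le_succ N)) hf.bddMeas
    simp only [List.replicate_zero, List.nil_append, pow_zero]
    linarith
  | succ k ih =>
    set H := Nat.sqrt N with hH
    have hH1 : 1 ≤ H := Nat.le_sqrt.2 (by simpa using hN)
    have hH' : (0 : ℝ) < H := by exact_mod_cast hH1
    set Ls := List.replicate k (2 * H) ++ [2 * N, M] with hLs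
    set ψ : ℕ → ℝ := fun h => gowersForm μ T Ls (fun x => f x * conj (f (T^[h] x)))
    -- Convexity of `t ↦ t⁶` passes the sixth power inside the average over `h`.
    have h1 : wwAverage μ T (k + 2) N f ^ 6 ≤ (1 / (H : ℝ)) * ∑ h ∈ Finset.Icc 1 H,
        wwAverage μ T (k + 1) N (fun x => f x * conj (f (T^[h] x))) ^ 6 := by
      have h := pow_sum_div_card_le_sum_pow (s := Finset.Icc 1 H)
        (f := fun h => wwAverage μ T (k + 1) N (fun x => f x * conj (f (T^[h] x)))) (n := 5)
        fun h _ => wwAverage_nonneg _ _ _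
      rw [Nat.card_Icc, Nat.add_sub_cancel] at h
      rw [wwAverage_succ_succ, ← hH, mul_pow]
      calc _ = (1 / (H : ℝ)) * ((∑ h ∈ Finset.Icc 1 H,
            wwAverage μ T (k + 1) N (fun x => f x * conj (f (T^[h] x)))) ^ (5 + 1) / H ^ 5) := by
            field_simp
        _ ≤ _ := mul_le_mul_of_nonneg_left h (by positivity)
    have h2 : ∑ h ∈ Finset.Icc 1 H,
        wwAverage μ T (k + 1) N (fun x => f x * conj (f (T^[h] x))) ^ 6 ≤
        ∑ h ∈ Finset.Icc 1 H, (32 * 4 ^ k * ψ h + 32 * ((M : ℝ) / N) ^ 2) :=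
      Finset.sum_le_sum fun h _ => ih (hf.mul_conj_comp (hT.measurable.iterate h))
    have h3 := sum_gowersForm_le hT (Ls := Ls) (by simp [hLs]) hH1 (s := Finset.Icc 1 H)
      (fun h hh => by have := Finset.mem_Icc.1 hh; simp only [Finset.mem_range]; omega) hf.bddMeas
    have h4 : (0 : ℝ) < 32 * 4 ^ k := by positivity
    rw [List.replicate_succ, List.cons_append]
    calc _ ≤ (1 / (H : ℝ)) * ∑ h ∈ Finset.Icc 1 H, (32 * 4 ^ k * ψ h + 32 * ((M : ℝ) / N) ^ 2) :=
          h1.trans (mul_le_mul_of_nonneg_left h2 (by positivity))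
      _ = 32 * 4 ^ k * ((1 / (H : ℝ)) * ∑ h ∈ Finset.Icc 1 H, ψ h) + 32 * ((M : ℝ) / N) ^ 2 := by
          rw [Finset.sum_add_distrib, ← Finset.mul_sum]
          simp only [Finset.sum_const, Nat.card_Icc, Nat.add_sub_cancel, nsmul_eq_mul]
          field_simp
      _ ≤ 32 * 4 ^ k * (4 * gowersForm μ T (2 * H :: Ls) f) + 32 * ((M : ℝ) / N) ^ 2 :=
          add_le_add (mul_le_mul_of_nonneg_left h3 h4.le) le_rfl
      _ = _ := by ring

/-- The first `k + 1` sides shrink one at a time. Each step doubles the form and the accumulated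
error and adds `8δ`, whence `8δ(2^{k+1} - 1)`. -/
theorem gowersForm_replicate_le_of_length [IsProbabilityMeasure μ] (hT : MeasurePreserving T μ μ)
    {H l N M : ℕ} (hH : 1 ≤ H) (hl : 1 ≤ l) (hN : 1 ≤ N) (hM : 1 ≤ M) {δ : ℝ}
    (h1 : ((l : ℝ) / H) ^ 2 ≤ δ) (h2 : ((M : ℝ) / N) ^ 2 ≤ δ) (k : ℕ)
    {f : X → ℂ} (hf : UnitMeas f) :
    gowersForm μ T (List.replicate k H ++ [N, M]) f ≤
      2 ^ (k + 1) * gowersForm μ T (List.replicate k l ++ [M, M]) f + 8 * δ * (2 ^ (k + 1) - 1) := by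
  have hδ : 0 ≤ δ := (sq_nonneg _).trans h1
  induction k generalizing f with
  | zero =>
    have h := crossForm_self_le_of_length hT hN hM [M] hf
    simp only [List.replicate_zero, List.nil_append, gowersForm_cons]
    norm_num
    linarith
  | succ k ih =>
    simp only [List.replicate_succ, List.cons_append]
    have h := crossForm_self_le_of_length hT hH hl (List.replicate k H ++ [N, M]) hf
    rw [← gowersForm_cons, ← gowersForm_cons] at h
    have hp : (1 : ℝ) ≤ 2 ^ (k + 1) := one_le_pow₀ one_le_two
    have h' := gowersForm_cons_le_cons (mul_nonneg (by positivity) (by linarith)) hT.measurable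
      (fun f hf => ih (f := f) hf) l hf
    rw [pow_succ 2 (k + 1)]
    linarith

/-- Each `gowersForm_cons_le` doubles the previous bound and adds the diagonal `1/⌊√M⌋`, whence the
factor `2^k - 1`. In the base case `W ≤ 1` allows `W³` to be replaced by `W`. -/
theorem gowersForm_replicate_le_wwAverage [IsProbabilityMeasure μ] (hT : MeasurePreserving T μ μ)
    {M : ℕ} (hM : 1 ≤ M) (k : ℕ) {f : X → ℂ} (hf : UnitMeas f) :
    gowersForm μ T (List.replicate k (Nat.sqrt M) ++ [M, M]) f ≤
      2 ^ (k + 1) * wwAverage μ T (k + 1) M f + (2 ^ k - 1) / (Nat.sqrt M : ℝ) := by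
  induction k generalizing f with
  | zero =>
    have h0 := wwAverage_nonneg (μ := μ) (T := T) 1 M f
    have h1 := wwAverage_le_one (μ := μ) hT.measurable 1 M hf
    have h3 : wwAverage μ T 1 M f ^ 3 ≤ wwAverage μ T 1 M f := pow_le_of_le_one h0 h1 (by norm_num)
    have h := gowersForm_pair_le hT hM hf
    simp only [List.replicate_zero, List.nil_append]
    norm_num
    linarith
  | succ k ih =>
    set l := Nat.sqrt M with hl
    have hl1 : 1 ≤ l := Nat.le_sqrt.2 (by simpa using hM)
    have hl' : (0 : ℝ) < l := by exact_mod_cast hl1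
    set Ls := List.replicate k l ++ [M, M] with hLs
    have hne : Ls ≠ [] := by simp [hLs]
    have hu : ∀ h, UnitMeas (fun x => f x * conj (f (T^[h] x))) := fun h =>
      hf.mul_conj_comp (hT.measurable.iterate h)
    have h := gowersForm_cons_le hT hl1 hf.bddMeas
      (fun h => gowersForm_nonneg (Ls := Ls) hT.measurable hne (hu h).bddMeas)
    have h0 : gowersForm μ T Ls (fun x => f x * conj (f x)) ≤ 1 :=
      gowersForm_le_one hT.measurable Ls (hf.mul hf.conj)
    have hs : ∑ h ∈ Finset.Icc 1 l, gowersForm μ T Ls (fun x => f x * conj (f (T^[h] x))) ≤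
        ∑ h ∈ Finset.Icc 1 l, (2 ^ (k + 1) *
          wwAverage μ T (k + 1) M (fun x => f x * conj (f (T^[h] x))) + (2 ^ k - 1) / (l : ℝ)) :=
      Finset.sum_le_sum fun h _ => ih (hu h)
    have hs' := mul_le_mul_of_nonneg_left hs (one_div_pos.2 hl').le
    have e : (1 / (l : ℝ)) * ∑ h ∈ Finset.Icc 1 l, (2 ^ (k + 1) *
          wwAverage μ T (k + 1) M (fun x => f x * conj (f (T^[h] x))) + (2 ^ k - 1) / (l : ℝ)) =
        2 ^ (k + 1) * wwAverage μ T (k + 2) M f + (2 ^ k - 1) / (l : ℝ) := by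
      rw [wwAverage_succ_succ, Finset.sum_add_distrib, ← Finset.mul_sum]
      simp only [Finset.sum_const, Nat.card_Icc, Nat.add_sub_cancel, nsmul_eq_mul, ← hl]
      field_simp
    rw [e] at hs'
    have h0' : (1 / (l : ℝ)) * gowersForm μ T Ls (fun x => f x * conj (f x)) ≤ 1 / l :=
      mul_le_of_le_one_right (by positivity) h0
    rw [List.replicate_succ, List.cons_append]
    refine h.trans ?_
    have e2 : ((2 : ℝ) ^ (k + 1) - 1) / l = 1 / l + 2 * ((2 ^ k - 1) / l) := by
      rw [pow_succ]; field_simp; ring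
    rw [e2, pow_succ 2 (k + 1)]
    linarith

end Comparison

/-! ### Estimates for the scale `⌊N^{1/4}⌋` -/

section Scales

theorem half_rpow_le_floor {N : ℕ} (hN : 1 ≤ N) :
    (N : ℝ) ^ (1 / 4 : ℝ) / 2 ≤ (⌊(N : ℝ) ^ (1 / 4 : ℝ)⌋₊ : ℝ) := by
  have h1 : 1 ≤ (N : ℝ) ^ (1 / 4 : ℝ) := Real.one_le_rpow (by exact_mod_cast hN) (by norm_num)
  have h2 := Nat.lt_floor_add_one ((N : ℝ) ^ (1 / 4 : ℝ))
  have h3 : (1 : ℝ) ≤ (⌊(N : ℝ) ^ (1 / 4 : ℝ)⌋₊ : ℝ) := by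
    exact_mod_cast Nat.le_floor (by simpa using h1)
  linarith

theorem one_le_floor_rpow {N : ℕ} (hN : 1 ≤ N) : 1 ≤ ⌊(N : ℝ) ^ (1 / 4 : ℝ)⌋₊ :=
  Nat.le_floor (by simpa using Real.one_le_rpow (by exact_mod_cast hN) (by norm_num))

theorem sqrt_le_two_mul_natSqrt {n : ℕ} (hn : 1 ≤ n) : √(n : ℝ) ≤ 2 * (Nat.sqrt n : ℝ) := by
  have h1 : (1 : ℝ) ≤ Nat.sqrt n := by
    exact_mod_cast Nat.le_sqrt.2 (by simpa using hn)
  have h2 : √(n : ℝ) ≤ Nat.sqrt n + 1 := Real.sqrt_le_iff.2 ⟨by positivity, by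
    exact_mod_cast (Nat.lt_succ_sqrt' n).le⟩
  linarith

/-- The diagonal error. At about `N^{-1/8}` it is the largest of the errors and fixes the exponent
of the final estimate. -/
theorem one_div_natSqrt_floor_le {N : ℕ} (hN : 1 ≤ N) :
    1 / (Nat.sqrt ⌊(N : ℝ) ^ (1 / 4 : ℝ)⌋₊ : ℝ) ≤ 4 * (N : ℝ) ^ (-(1 / 8) : ℝ) := by
  have hN' : (0 : ℝ) < N := by exact_mod_cast hN
  set M := ⌊(N : ℝ) ^ (1 / 4 : ℝ)⌋₊
  have hM : 1 ≤ M := one_le_floor_rpow hN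
  have hl : (0 : ℝ) < Nat.sqrt M := by
    exact_mod_cast Nat.le_sqrt.2 (by simpa using hM)
  have h1 : (N : ℝ) ^ (1 / 8 : ℝ) / 2 ≤ √(M : ℝ) := by
    refine Real.le_sqrt_of_sq_le ?_
    have e : ((N : ℝ) ^ (1 / 8 : ℝ)) ^ 2 = (N : ℝ) ^ (1 / 4 : ℝ) := by
      rw [← Real.rpow_natCast, ← Real.rpow_mul hN'.le]; norm_num
    rw [div_pow, e]
    have := half_rpow_le_floor hN
    have h0 : 0 ≤ (N : ℝ) ^ (1 / 4 : ℝ) := by positivity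
    linarith
  have h2 := sqrt_le_two_mul_natSqrt hM
  have h3 : 0 < (N : ℝ) ^ (1 / 8 : ℝ) := by positivity
  rw [Real.rpow_neg hN'.le, div_le_iff₀ hl, mul_assoc, inv_mul_eq_div, mul_div_assoc', le_div_iff₀ h3]
  linarith

theorem natSqrt_floor_div_sq_le {N : ℕ} (hN : 1 ≤ N) :
    ((Nat.sqrt ⌊(N : ℝ) ^ (1 / 4 : ℝ)⌋₊ : ℝ) / (2 * Nat.sqrt N : ℕ)) ^ 2 ≤
      (N : ℝ) ^ (-(1 / 8) : ℝ) := by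
  have hN' : (0 : ℝ) < N := by exact_mod_cast hN
  have hN1 : (1 : ℝ) ≤ N := by exact_mod_cast hN
  have h1 : (Nat.sqrt ⌊(N : ℝ) ^ (1 / 4 : ℝ)⌋₊ : ℝ) ≤ (N : ℝ) ^ (1 / 4 : ℝ) :=
    (Nat.cast_le.2 (Nat.sqrt_le_self _)).trans (Nat.floor_le (by positivity))
  have h2 := sqrt_le_two_mul_natSqrt hN
  have h3 : 0 < √(N : ℝ) := Real.sqrt_pos.2 hN'
  have h4 : (Nat.sqrt ⌊(N : ℝ) ^ (1 / 4 : ℝ)⌋₊ : ℝ) / (2 * Nat.sqrt N : ℕ) ≤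
      (N : ℝ) ^ (1 / 4 : ℝ) / √(N : ℝ) := by
    push_cast
    exact div_le_div₀ (by positivity) h1 h3 h2
  calc _ ≤ ((N : ℝ) ^ (1 / 4 : ℝ) / √(N : ℝ)) ^ 2 := pow_le_pow_left₀ (by positivity) h4 2
    _ = (N : ℝ) ^ (-(1 / 2) : ℝ) := by
        rw [Real.sqrt_eq_rpow, ← Real.rpow_sub hN', ← Real.rpow_natCast, ← Real.rpow_mul hN'.le]
        norm_num
    _ ≤ _ := Real.rpow_le_rpow_of_exponent_le hN1 (by norm_num)

theorem floor_div_sq_le {N : ℕ} (hN : 1 ≤ N) :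
    ((⌊(N : ℝ) ^ (1 / 4 : ℝ)⌋₊ : ℝ) / N) ^ 2 ≤ (N : ℝ) ^ (-(1 / 8) : ℝ) := by
  have hN' : (0 : ℝ) < N := by exact_mod_cast hN
  have hN1 : (1 : ℝ) ≤ N := by exact_mod_cast hN
  have h1 : (⌊(N : ℝ) ^ (1 / 4 : ℝ)⌋₊ : ℝ) ≤ (N : ℝ) ^ (1 / 4 : ℝ) := Nat.floor_le (by positivity)
  calc _ ≤ ((N : ℝ) ^ (1 / 4 : ℝ) / (N : ℝ) ^ (1 : ℝ)) ^ 2 := by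
        rw [Real.rpow_one]
        exact pow_le_pow_left₀ (by positivity) (div_le_div_of_nonneg_right h1 hN'.le) 2
    _ = (N : ℝ) ^ (-(3 / 2) : ℝ) := by
        rw [← Real.rpow_sub hN', ← Real.rpow_natCast, ← Real.rpow_mul hN'.le]
        norm_num
    _ ≤ _ := Real.rpow_le_rpow_of_exponent_le hN1 (by norm_num)

end Scales

/-! ### Averages of sums, and a lower bound for averages -/

/-- The sixth power of a Wiener-Wintner average of a sum is controlled by the averages of the
summands at a smaller scale, when the sum is bounded by `1`. -/
theorem exists_wwAverage_add_pow_six_le (k : ℕ) : ∃ C : ℝ, 0 < C ∧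
    ∀ {X : Type*} [MeasurableSpace X] {μ : Measure X} [IsProbabilityMeasure μ] {T : X → X},
      MeasurePreserving T μ μ → ∀ f g : X → ℂ, UnitMeas f → UnitMeas g →
        UnitMeas (fun x => f x + g x) → ∀ N : ℕ, 1 ≤ N →
          wwAverage μ T (k + 1) N (fun x => f x + g x) ^ 6 ≤
            C * ((N : ℝ) ^ (-(1 / 8) : ℝ)
              + wwAverage μ T (k + 1) ⌊(N : ℝ) ^ (1 / 4 : ℝ)⌋₊ f
              + wwAverage μ T (k + 1) ⌊(N : ℝ) ^ (1 / 4 : ℝ)⌋₊ g) := by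
  obtain ⟨D, hD, hadd⟩ := exists_gowersForm_add_le (k + 1)
  -- Factors: `32 · 4^k` from the upper comparison, `2^(k+1)` from shrinking, `D` from the
  -- quasi-triangle inequality, `8 · 2^(k+1)` from the lower comparison of both summands. The inner
  -- `8 · 2^(k+1)` and the last `32` absorb the length errors.
  refine ⟨32 * 4 ^ k * (2 ^ (k + 1) * (D * (8 * 2 ^ (k + 1))) + 8 * 2 ^ (k + 1)) + 32,
    by positivity, fun {X} _ {μ} _ {T} hT f g hf hg hfg N hN => ?_⟩
  set M := ⌊(N : ℝ) ^ (1 / 4 : ℝ)⌋₊ with hMd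
  set ε := (N : ℝ) ^ (-(1 / 8) : ℝ) with hε
  have hM : 1 ≤ M := one_le_floor_rpow hN
  have hl : 1 ≤ Nat.sqrt M := Nat.le_sqrt.2 (by simpa using hM)
  have hH : 1 ≤ Nat.sqrt N := Nat.le_sqrt.2 (by simpa using hN)
  have hε0 : 0 ≤ ε := by positivity
  set G : (X → ℂ) → ℝ := gowersForm μ T (List.replicate k (Nat.sqrt M) ++ [M, M]) with hG
  set F := wwAverage μ T (k + 1) M f
  set F' := wwAverage μ T (k + 1) M g
  have hF0 : 0 ≤ F := wwAverage_nonneg _ _ _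
  have hF'0 : 0 ≤ F' := wwAverage_nonneg _ _ _
  have hMN : ((M : ℝ) / N) ^ 2 ≤ ε := floor_div_sq_le hN
  have h1 := wwAverage_pow_six_le_gowersForm hT hN hM k hfg
  have h2 : gowersForm μ T (List.replicate k (2 * Nat.sqrt N) ++ [2 * N, M]) (fun x => f x + g x) ≤
      2 ^ (k + 1) * G (fun x => f x + g x) + 8 * ε * (2 ^ (k + 1) - 1) := by
    refine gowersForm_replicate_le_of_length hT (by omega) hl (by omega) hM
      (natSqrt_floor_div_sq_le hN) (le_trans ?_ hMN) k hfg
    push_cast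
    have hN' : (0 : ℝ) < N := by exact_mod_cast hN
    exact pow_le_pow_left₀ (by positivity)
      (div_le_div_of_nonneg_left (by positivity) hN' (by linarith)) 2
  have h3 : G (fun x => f x + g x) ≤ D * (G f + G g) :=
    hadd hT.measurable _ (by simp) f g hf.bddMeas hg.bddMeas
  have hinv : 1 / (Nat.sqrt M : ℝ) ≤ 4 * ε := one_div_natSqrt_floor_le hN
  have hp : (1 : ℝ) ≤ 2 ^ (k + 1) := one_le_pow₀ one_le_two
  have hlow : ∀ u : X → ℂ, UnitMeas u → G u ≤ 2 ^ (k + 1) * (wwAverage μ T (k + 1) M u + 4 * ε) := by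
    intro u hu
    refine (gowersForm_replicate_le_wwAverage hT hM k hu).trans ?_
    rw [mul_add]
    refine add_le_add le_rfl ?_
    rw [div_eq_mul_one_div]
    refine mul_le_mul ?_ hinv (by positivity) (by positivity)
    rw [pow_succ]
    have : (0 : ℝ) < 2 ^ k := by positivity
    linarith
  have h4 : G f + G g ≤ 8 * 2 ^ (k + 1) * (ε + F + F') := by
    have := hlow f hf
    have := hlow g hg
    have h5 : 0 ≤ (2 : ℝ) ^ (k + 1) * F := by positivity
    have h6 : 0 ≤ (2 : ℝ) ^ (k + 1) * F' := by positivity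
    simp only [mul_add] at *
    linarith
  set S := ε + F + F'
  have hεS : ε ≤ S := by simp only [S]; linarith
  calc _ ≤ 32 * 4 ^ k * (2 ^ (k + 1) * (D * (8 * 2 ^ (k + 1) * S)) + 8 * S * 2 ^ (k + 1)) +
        32 * S := by
        refine h1.trans (add_le_add (mul_le_mul_of_nonneg_left (h2.trans (add_le_add
          (mul_le_mul_of_nonneg_left (h3.trans (mul_le_mul_of_nonneg_left h4 hD.le))
            (by positivity)) ?_)) (by positivity)) ?_)
        · refine mul_le_mul (by linarith) (by linarith) (by linarith) (by linarith)
        · linarith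
    _ = _ := by ring

theorem add_rpow_le_rpow_add_rpow {a b p : ℝ} (ha : 0 ≤ a) (hb : 0 ≤ b) (hp : 0 ≤ p) (hp1 : p ≤ 1) :
    (a + b) ^ p ≤ a ^ p + b ^ p := by
  lift a to NNReal using ha
  lift b to NNReal using hb
  exact_mod_cast NNReal.rpow_add_le_add_rpow a b hp hp1

/-- The Wiener-Wintner averages of a sum are controlled by those of the summands. -/
theorem exists_wwAverage_add_le (k : ℕ) : ∃ C : ℝ, 0 < C ∧
    ∀ {X : Type*} [MeasurableSpace X] {μ : Measure X} [IsProbabilityMeasure μ] {T : X → X},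
      MeasurePreserving T μ μ → ∀ f g : X → ℂ, UnitMeas f → UnitMeas g → ∀ N : ℕ, 1 ≤ N →
          wwAverage μ T (k + 1) N (fun x => f x + g x) ≤
            C * ((N : ℝ) ^ (-(1 / 48) : ℝ)
              + wwAverage μ T (k + 1) ⌊(N : ℝ) ^ (1 / 4 : ℝ)⌋₊ f ^ (1 / 6 : ℝ)
              + wwAverage μ T (k + 1) ⌊(N : ℝ) ^ (1 / 4 : ℝ)⌋₊ g ^ (1 / 6 : ℝ)) := by
  obtain ⟨C, hC, h⟩ := exists_wwAverage_add_pow_six_le k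
  refine ⟨2 ^ (2 ^ (k + 1) / 3 : ℝ) * C ^ (1 / 6 : ℝ), by positivity,
    fun {X} _ {μ} _ {T} hT f g hf hg N hN => ?_⟩
  set M := ⌊(N : ℝ) ^ (1 / 4 : ℝ)⌋₊
  -- Halving both functions keeps their sum bounded by `1`; homogeneity restores the factor `2`.
  have half : ∀ {u : X → ℂ}, UnitMeas u →
      Measurable (fun x => (1 / 2 : ℂ) * u x) ∧ ∀ x, ‖(1 / 2 : ℂ) * u x‖ ≤ 1 / 2 := by
    intro u hu
    refine ⟨hu.meas.const_mul _, fun x => ?_⟩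
    rw [norm_mul]
    have := hu.le_one x
    norm_num
    linarith
  have hf2 := half hf
  have hg2 := half hg
  have hle : ∀ u : X → ℂ, wwAverage μ T (k + 1) M (fun x => (1 / 2 : ℂ) * u x) ≤
      wwAverage μ T (k + 1) M u := by
    intro u
    rw [wwAverage_const_mul]
    refine mul_le_of_le_one_left (wwAverage_nonneg _ _ _) ?_
    exact Real.rpow_le_one (norm_nonneg _) (by norm_num) (by positivity)
  have h6 := h hT _ _ ⟨hf2.1, fun x => (hf2.2 x).trans (by norm_num)⟩
    ⟨hg2.1, fun x => (hg2.2 x).trans (by norm_num)⟩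
    ⟨hf2.1.add hg2.1, fun x => (norm_add_le _ _).trans (by linarith [hf2.2 x, hg2.2 x])⟩ N hN
  set W := wwAverage μ T (k + 1) N (fun x => (1 / 2 : ℂ) * f x + (1 / 2 : ℂ) * g x) with hW
  have hW0 : 0 ≤ W := wwAverage_nonneg _ _ _
  have e : wwAverage μ T (k + 1) N (fun x => f x + g x) = 2 ^ (2 ^ (k + 1) / 3 : ℝ) * W := by
    have : (fun x => f x + g x) = fun x => (2 : ℂ) * ((1 / 2 : ℂ) * f x + (1 / 2 : ℂ) * g x) := by
      funext x; ring
    rw [this, wwAverage_const_mul, hW]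
    norm_num
  set F := wwAverage μ T (k + 1) M f
  set F' := wwAverage μ T (k + 1) M g
  have hF0 : 0 ≤ F := wwAverage_nonneg _ _ _
  have hF'0 : 0 ≤ F' := wwAverage_nonneg _ _ _
  have hN0 : (0 : ℝ) ≤ N := Nat.cast_nonneg N
  have h7 : W ^ 6 ≤ C * ((N : ℝ) ^ (-(1 / 8) : ℝ) + F + F') :=
    h6.trans (mul_le_mul_of_nonneg_left (add_le_add (add_le_add le_rfl (hle f)) (hle g)) hC.le)
  have h8 : W ≤ C ^ (1 / 6 : ℝ) * ((N : ℝ) ^ (-(1 / 48) : ℝ) + F ^ (1 / 6 : ℝ) + F' ^ (1 / 6 : ℝ)) := by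
    calc W = (W ^ 6) ^ (1 / 6 : ℝ) := by
          rw [← Real.rpow_natCast, ← Real.rpow_mul hW0]; norm_num
      _ ≤ (C * ((N : ℝ) ^ (-(1 / 8) : ℝ) + F + F')) ^ (1 / 6 : ℝ) :=
          Real.rpow_le_rpow (by positivity) h7 (by norm_num)
      _ = C ^ (1 / 6 : ℝ) * ((N : ℝ) ^ (-(1 / 8) : ℝ) + F + F') ^ (1 / 6 : ℝ) :=
          Real.mul_rpow hC.le (by positivity)
      _ ≤ C ^ (1 / 6 : ℝ) * (((N : ℝ) ^ (-(1 / 8) : ℝ)) ^ (1 / 6 : ℝ) + F ^ (1 / 6 : ℝ) +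
            F' ^ (1 / 6 : ℝ)) := by
          refine mul_le_mul_of_nonneg_left ?_ (by positivity)
          exact (add_rpow_le_rpow_add_rpow (by positivity) hF'0 (by norm_num) (by norm_num)).trans
            (add_le_add (add_rpow_le_rpow_add_rpow (by positivity) hF0 (by norm_num) (by norm_num))
              le_rfl)
      _ = _ := by
          rw [← Real.rpow_mul hN0]; norm_num
  rw [e, mul_assoc]
  exact mul_le_mul_of_nonneg_left h8 (by positivity)

/-- A lower bound for the Wiener-Wintner averages of a function in terms of its `L²` norm. -/
theorem exists_le_wwAverage (k : ℕ) : ∀ δ : ℝ, 0 < δ → ∃ (c : ℝ) (N₀ : ℕ), 0 < c ∧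
    ∀ {X : Type*} [MeasurableSpace X] {μ : Measure X} [IsProbabilityMeasure μ] {T : X → X},
      MeasurePreserving T μ μ → ∀ f : X → ℂ, UnitMeas f → ∀ N : ℕ, N₀ ≤ N →
        c * (N : ℝ) ^ (-(1 / 3) : ℝ) * (∫ x, ‖f x‖ ^ 2 ∂μ - δ) ≤ wwAverage μ T (k + 1) N f := by
  induction k with
  | zero =>
    refine fun δ hδ => ⟨1, 1, one_pos, fun {X} _ {μ} _ {T} hT f hf N hN => ?_⟩
    have hN' : (0 : ℝ) < N := by exact_mod_cast hN
    set p := ∫ x, ‖f x‖ ^ 2 ∂μ with hp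
    have hp0 : 0 ≤ p := integral_nonneg fun x => sq_nonneg _
    have hp1 : p ≤ 1 := by
      have := integral_mono (hf.bddMeas.integrable_norm_sq (μ := μ)) (integrable_const 1)
        fun x => pow_le_one₀ (norm_nonneg _) (hf.le_one x)
      simpa using this
    have h := integral_norm_sq_le_wwAverage_one hT hN hf.bddMeas
    have h3 : ((N : ℝ) ^ (-(1 / 3) : ℝ) * p) ^ 3 ≤ wwAverage μ T 1 N f ^ 3 := by
      have e : ((N : ℝ) ^ (-(1 / 3) : ℝ)) ^ 3 = (N : ℝ)⁻¹ := by
        rw [← Real.rpow_natCast, ← Real.rpow_mul hN'.le, ← Real.rpow_neg_one]; norm_num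
      rw [mul_pow, e, inv_mul_le_iff₀ hN']
      exact (pow_le_of_le_one hp0 hp1 (by norm_num)).trans h
    have h4 := le_of_pow_le_pow_left₀ (by norm_num) (wwAverage_nonneg _ _ _) h3
    have h5 : 0 ≤ (N : ℝ) ^ (-(1 / 3) : ℝ) := by positivity
    rw [one_mul, zero_add]
    nlinarith
  | succ k ih =>
    intro δ hδ
    -- The bound is affine in `‖f‖₂²`, so it can be averaged over `h`. The loss `δ²/4`, together
    -- with the diagonal bound `1/H ≤ δ²/2` arranged by `B`, is what `h9` can afford.
    obtain ⟨c, N₀, hc, h⟩ := ih (δ ^ 2 / 4) (by positivity)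
    set B := ⌈2 / δ ^ 2⌉₊ + 1 with hB
    refine ⟨c * δ, max N₀ (B * B), by positivity, fun {X} _ {μ} _ {T} hT f hf N hN => ?_⟩
    have hTm := hT.measurable
    set H := Nat.sqrt N with hH
    have hBH : B ≤ H := Nat.le_sqrt.2 ((le_max_right _ _).trans hN)
    have hH1 : 1 ≤ H := by omega
    have hH' : (0 : ℝ) < H := by exact_mod_cast hH1
    have hHinv : 1 / (H : ℝ) ≤ δ ^ 2 / 2 := by
      have h1 : 2 / δ ^ 2 ≤ (H : ℝ) := by
        refine (Nat.le_ceil _).trans ?_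
        exact_mod_cast (show ⌈2 / δ ^ 2⌉₊ ≤ H by omega)
      rw [div_le_iff₀ (by positivity)] at h1
      rw [div_le_iff₀ hH']
      linarith
    set p := ∫ x, ‖f x‖ ^ 2 ∂μ with hp
    set q : ℕ → ℝ := fun h => ∫ x, ‖f x * conj (f (T^[h] x))‖ ^ 2 ∂μ with hq
    set F : X → ℂ := fun x => f x * conj (f x) with hF
    have hFu : UnitMeas F := hf.mul hf.conj
    have hFr : ∀ x, F x = ((‖f x‖ ^ 2 : ℝ) : ℂ) := fun x => by
      rw [hF]; simp only; rw [Complex.mul_conj, Complex.normSq_eq_norm_sq]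
    have hqF : ∀ h, gowersForm μ T [] (fun x => F x * conj (F (T^[h] x))) = q h := by
      intro h
      have e : (fun x => F x * conj (F (T^[h] x))) =
          fun x => ((‖f x * conj (f (T^[h] x))‖ ^ 2 : ℝ) : ℂ) := by
        funext x
        rw [hFr, hFr, Complex.conj_ofReal, norm_mul, RCLike.norm_conj, mul_pow]
        push_cast
        rfl
      simp only [gowersForm, e, hq]
      rw [integral_complex_ofReal, Complex.ofReal_re]
    -- Quantitative recurrence for `F = |f|²`: the squared `L²` norm of its orbit average is at
    -- least `(∫ F)² = p²`, and is bounded above by the diagonal plus twice the average of the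
    -- correlations `q h`.
    have hE : p ^ 2 ≤ 1 / H + 2 * ((1 / (H : ℝ)) * ∑ h ∈ Finset.Icc 1 H, q h) := by
      have h1 := gowersForm_cons_le hT (Ls := []) hH1 hFu.bddMeas (fun h => by
        rw [hqF]; exact integral_nonneg fun x => sq_nonneg _)
      simp only [hqF] at h1
      have h2 : gowersForm μ T [] (fun x => F x * conj (F x)) ≤ 1 :=
        gowersForm_le_one hTm [] (hFu.mul hFu.conj)
      have h3 : p ^ 2 ≤ gowersForm μ T [H] F := by
        rw [gowersForm_cons, crossForm_nil_self hTm H hFu.bddMeas]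
        have hA := hFu.bddMeas.orbitAvg hTm H
        have h4 : ∫ x, orbitAvg T H F x ∂μ = p := by
          simp only [orbitAvg]
          rw [integral_const_mul, integral_finsetSum _ fun a _ =>
            (hFu.bddMeas.comp (hTm.iterate a)).integrable]
          have : ∀ a, ∫ x, F (T^[a] x) ∂μ = (p : ℂ) := by
            intro a
            rw [integral_comp_iterate hT a hFu.meas.aestronglyMeasurable, hp,
              ← integral_complex_ofReal]
            exact integral_congr_ae (ae_of_all _ hFr)
          simp only [this, Finset.sum_const, Nat.card_Icc, Nat.add_sub_cancel, nsmul_eq_mul]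
          have : (H : ℂ) ≠ 0 := by exact_mod_cast hH'.ne'
          field_simp
        have hre : Integrable (fun x => (orbitAvg T H F x).re) μ := hA.integrable.re
        have h5 : ∫ x, (2 * p * (orbitAvg T H F x).re - p ^ 2) ∂μ ≤
            ∫ x, ‖orbitAvg T H F x‖ ^ 2 ∂μ := by
          refine integral_mono ((hre.const_mul _).sub (integrable_const _))
            hA.integrable_norm_sq fun x => ?_
          have h6 : (orbitAvg T H F x).re ^ 2 ≤ ‖orbitAvg T H F x‖ ^ 2 :=
            sq_le_sq.2 (by rw [abs_norm]; exact Complex.abs_re_le_norm _)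
          simp only
          nlinarith [sq_nonneg ((orbitAvg T H F x).re - p)]
        have h7 : ∫ x, (orbitAvg T H F x).re ∂μ = p := by
          have := integral_re (𝕜 := ℂ) (hA.integrable (μ := μ))
          rw [h4] at this
          simpa using this
        rw [integral_sub (hre.const_mul _) (integrable_const _), integral_const_mul] at h5
        simp only [h7, integral_const, probReal_univ, one_smul] at h5
        linarith
      have h4 : (1 / (H : ℝ)) * gowersForm μ T [] (fun x => F x * conj (F x)) ≤ 1 / H :=
        mul_le_of_le_one_right (by positivity) h2
      linarith
    set r := c * (N : ℝ) ^ (-(1 / 3) : ℝ) with hr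
    have hr0 : 0 ≤ r := by positivity
    have hmain : r * ((1 / (H : ℝ)) * ∑ h ∈ Finset.Icc 1 H, q h - δ ^ 2 / 4) ≤
        wwAverage μ T (k + 2) N f := by
      rw [wwAverage_succ_succ, ← hH]
      calc _ = (1 / (H : ℝ)) * ∑ h ∈ Finset.Icc 1 H, r * (q h - δ ^ 2 / 4) := by
            rw [← Finset.mul_sum, Finset.sum_sub_distrib]
            simp only [Finset.sum_const, Nat.card_Icc, Nat.add_sub_cancel, nsmul_eq_mul]
            field_simp
        _ ≤ _ := mul_le_mul_of_nonneg_left (Finset.sum_le_sum fun m _ =>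
            h hT _ (hf.mul_conj_comp (hTm.iterate m)) N ((le_max_left _ _).trans hN))
            (by positivity)
    refine le_trans ?_ hmain
    -- The right side is at least `(p² - δ²) / 2`, which exceeds `δ (p - δ)` by `(p - δ)² / 2`.
    have h9 : δ * (p - δ) ≤ (1 / (H : ℝ)) * ∑ h ∈ Finset.Icc 1 H, q h - δ ^ 2 / 4 := by
      nlinarith [sq_nonneg (p - δ)]
    calc c * δ * (N : ℝ) ^ (-(1 / 3) : ℝ) * (p - δ) = r * (δ * (p - δ)) := by rw [hr]; ring
      _ ≤ _ := mul_le_mul_of_nonneg_left h9 hr0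

/-! ### Representatives of essentially bounded functions -/

section EssentiallyBounded

variable {X : Type*} [MeasurableSpace X] {μ : Measure X}

theorem Lp_top_ae_norm_le (f : Lp ℂ ⊤ μ) : ∀ᵐ x ∂μ, ‖f x‖ ≤ ‖f‖ := by
  have h := ae_le_eLpNormEssSup (f := f) (μ := μ)
  rw [← eLpNorm_exponent_top] at h
  filter_upwards [h] with x hx
  rw [Lp.norm_def, ← toReal_enorm]
  exact ENNReal.toReal_mono (Lp.eLpNorm_ne_top f) hx

/-- Truncation gives a representative bounded everywhere, so that pointwise suprema over `t` are
finite at every point. -/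
theorem exists_unitMeas_ae_eq (f : Lp ℂ ⊤ μ) {R : ℝ} (hR : 0 < R) (hf : ‖f‖ ≤ R) :
    ∃ g : X → ℂ, UnitMeas g ∧ f =ᵐ[μ] fun x => (R : ℂ) * g x := by
  have hm : Measurable (fun x => (R : ℂ)⁻¹ * f x) :=
    (Lp.stronglyMeasurable f).measurable.const_mul _
  have hRc : (R : ℂ) ≠ 0 := by exact_mod_cast hR.ne'
  refine ⟨Set.indicator {x | ‖(R : ℂ)⁻¹ * f x‖ ≤ 1} (fun x => (R : ℂ)⁻¹ * f x),
    ⟨hm.indicator (measurableSet_le hm.norm measurable_const), fun x => ?_⟩, ?_⟩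
  · by_cases hx : x ∈ {x | ‖(R : ℂ)⁻¹ * f x‖ ≤ 1}
    · rw [Set.indicator_of_mem hx]
      exact hx
    · rw [Set.indicator_of_notMem hx]
      simp
  · filter_upwards [Lp_top_ae_norm_le f] with x hx
    have : x ∈ {x | ‖(R : ℂ)⁻¹ * f x‖ ≤ 1} := by
      change ‖(R : ℂ)⁻¹ * f x‖ ≤ 1
      rw [norm_mul, norm_inv, Complex.norm_real, Real.norm_of_nonneg hR.le, inv_mul_le_iff₀ hR]
      linarith
    rw [Set.indicator_of_mem this, mul_inv_cancel_left₀ hRc]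

end EssentiallyBounded

/-! ### Polynomial decay rates -/

section PolynomialDecay

open Filter Asymptotics Topology

theorem natCast_rpow_isBigO {a b : ℝ} (h : a ≤ b) :
    (fun N : ℕ => (N : ℝ) ^ (-b)) =O[atTop] fun N : ℕ => (N : ℝ) ^ (-a) := by
  refine IsBigO.of_bound 1 ?_
  filter_upwards [eventually_ge_atTop 1] with N hN
  have hN1 : (1 : ℝ) ≤ N := by exact_mod_cast hN
  rw [one_mul, Real.norm_of_nonneg (by positivity), Real.norm_of_nonneg (by positivity)]
  exact Real.rpow_le_rpow_of_exponent_le hN1 (by linarith)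

theorem PolyDecayWith_anti {a b : ℝ} (h : a ≤ b) : PolyDecayWith b ⊆ PolyDecayWith a :=
  fun _ hr => IsBigO.trans hr (natCast_rpow_isBigO h)

theorem const_mul_mem_PolyDecayWith {c α : ℝ} {r : ℕ → ℝ} (hr : r ∈ PolyDecayWith α) :
    (fun N => c * r N) ∈ PolyDecayWith α :=
  IsBigO.const_mul_left hr c

theorem tendsto_floor_rpow_atTop :
    Tendsto (fun N : ℕ => ⌊(N : ℝ) ^ (1 / 4 : ℝ)⌋₊) atTop atTop :=
  tendsto_nat_floor_atTop.comp
    ((tendsto_rpow_atTop (by norm_num)).comp tendsto_natCast_atTop_atTop)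

theorem comp_floor_mem_PolyDecayWith {m : ℝ} (hm : 0 ≤ m) {r : ℕ → ℝ} (hr : r ∈ PolyDecayWith m) :
    (fun N : ℕ => r ⌊(N : ℝ) ^ (1 / 4 : ℝ)⌋₊) ∈ PolyDecayWith (m / 4) := by
  refine (IsBigO.comp_tendsto hr tendsto_floor_rpow_atTop).trans ?_
  refine IsBigO.of_bound (2 ^ m) ?_
  filter_upwards [eventually_ge_atTop 1] with N hN
  have hN' : (0 : ℝ) < N := by exact_mod_cast hN
  rw [Function.comp_apply, Real.norm_of_nonneg (by positivity), Real.norm_of_nonneg (by positivity)]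
  calc (⌊(N : ℝ) ^ (1 / 4 : ℝ)⌋₊ : ℝ) ^ (-m) ≤ ((N : ℝ) ^ (1 / 4 : ℝ) / 2) ^ (-m) :=
        Real.rpow_le_rpow_of_nonpos (by positivity) (half_rpow_le_floor hN) (by linarith)
    _ = 2 ^ m * (N : ℝ) ^ (-(m / 4)) := by
        rw [Real.div_rpow (by positivity) (by norm_num), ← Real.rpow_mul hN'.le,
          Real.rpow_neg (by norm_num : (0 : ℝ) ≤ 2), div_inv_eq_mul, mul_comm]
        congr 2
        ring

theorem rpow_mem_PolyDecayWith {m p : ℝ} (hp : 0 ≤ p) {r : ℕ → ℝ} (hr : r ∈ PolyDecayWith m) :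
    (fun N : ℕ => r N ^ p) ∈ PolyDecayWith (m * p) := by
  refine (IsBigO.rpow hp (Eventually.of_forall fun N => by positivity) hr).congr_right fun N => ?_
  rw [← Real.rpow_mul (Nat.cast_nonneg N), neg_mul]

variable {X : Type*} [MeasurableSpace X] {μ : Measure X} {T : X → X}

theorem wwAverage_ae_zero (hT : MeasurePreserving T μ μ) (k N : ℕ) {f : X → ℂ}
    (hf : f =ᵐ[μ] fun _ => 0) : wwAverage μ T (k + 1) N f = 0 := by
  have h := wwAverage_const_mul (μ := μ) (T := T) k N 0 (fun _ => 0)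
  rw [norm_zero, Real.zero_rpow (by positivity)] at h
  simp only [zero_mul] at h
  rw [wwAverage_congr_ae hT (k + 1) N hf, h]

theorem wwAverage_of_ae_eq_const_mul (hT : MeasurePreserving T μ μ) (k N : ℕ) {f g : X → ℂ} {R : ℝ}
    (hR : 0 < R) (hfg : f =ᵐ[μ] fun x => (R : ℂ) * g x) :
    wwAverage μ T (k + 1) N f = R ^ (2 ^ (k + 1) / 3 : ℝ) * wwAverage μ T (k + 1) N g := by
  rw [wwAverage_congr_ae hT (k + 1) N hfg, wwAverage_const_mul, Complex.norm_real,
    Real.norm_of_nonneg hR.le]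

theorem wwAverage_mem_PolyDecayWith_of_ae_eq (hT : MeasurePreserving T μ μ) (k : ℕ) {f g : X → ℂ}
    {R : ℝ} (hR : 0 < R) (hfg : f =ᵐ[μ] fun x => (R : ℂ) * g x) {α : ℝ}
    (hf : (fun N => wwAverage μ T (k + 1) N f) ∈ PolyDecayWith α) :
    (fun N => wwAverage μ T (k + 1) N g) ∈ PolyDecayWith α := by
  simp only [wwAverage_of_ae_eq_const_mul hT k _ hR hfg] at hf
  exact (isBigO_const_mul_left_iff (Real.rpow_pos_of_pos hR _).ne').1 hf

variable [IsProbabilityMeasure μ]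

/-- Passing to scale `N^{1/4}` and taking sixth roots divides the rate by `24`. The restriction `m ≤
1/2` ensures `m / 24 ≤ 1/48`, the rate of the error term. -/
theorem wwAverage_add_mem_PolyDecayWith (hT : MeasurePreserving T μ μ) (k : ℕ)
    (f₁ f₂ : Lp ℂ ⊤ μ) {m : ℝ} (hm : 0 ≤ m) (hm' : m ≤ 1 / 2)
    (h₁ : (fun N => wwAverage μ T (k + 1) N f₁) ∈ PolyDecayWith m)
    (h₂ : (fun N => wwAverage μ T (k + 1) N f₂) ∈ PolyDecayWith m) :
    (fun N => wwAverage μ T (k + 1) N (f₁ + f₂ : Lp ℂ ⊤ μ)) ∈ PolyDecayWith (m / 24) := by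
  set R : ℝ := 1 + ‖f₁‖ + ‖f₂‖ with hR
  have hR0 : 0 < R := by positivity
  obtain ⟨g₁, hg₁, e₁⟩ := exists_unitMeas_ae_eq f₁ hR0 (by
    rw [hR]; linarith [norm_nonneg f₁, norm_nonneg f₂])
  obtain ⟨g₂, hg₂, e₂⟩ := exists_unitMeas_ae_eq f₂ hR0 (by
    rw [hR]; linarith [norm_nonneg f₁, norm_nonneg f₂])
  have e : (f₁ + f₂ : Lp ℂ ⊤ μ) =ᵐ[μ] fun x => (R : ℂ) * (g₁ x + g₂ x) := by
    filter_upwards [Lp.coeFn_add f₁ f₂, e₁, e₂] with x h h1 h2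
    rw [h, Pi.add_apply, h1, h2, mul_add]
  simp only [wwAverage_of_ae_eq_const_mul hT k _ hR0 e]
  refine const_mul_mem_PolyDecayWith ?_
  have key : ∀ g : X → ℂ, (fun N => wwAverage μ T (k + 1) N g) ∈ PolyDecayWith m →
      (fun N : ℕ => wwAverage μ T (k + 1) ⌊(N : ℝ) ^ (1 / 4 : ℝ)⌋₊ g ^ (1 / 6 : ℝ)) ∈
        PolyDecayWith (m / 24) := by
    intro g hg
    have h := rpow_mem_PolyDecayWith (p := 1 / 6) (by norm_num) (comp_floor_mem_PolyDecayWith hm hg)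
    rwa [show m / 4 * (1 / 6) = m / 24 by ring] at h
  have k₁ := key g₁ (wwAverage_mem_PolyDecayWith_of_ae_eq hT k hR0 e₁ h₁)
  have k₂ := key g₂ (wwAverage_mem_PolyDecayWith_of_ae_eq hT k hR0 e₂ h₂)
  have k₀ : (fun N : ℕ => (N : ℝ) ^ (-(1 / 48) : ℝ)) ∈ PolyDecayWith (m / 24) :=
    natCast_rpow_isBigO (by linarith)
  obtain ⟨C, hC, h⟩ := exists_wwAverage_add_le k
  refine IsBigO.trans (IsBigO.of_bound C ?_) ((IsBigO.add k₀ k₁).add k₂)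
  filter_upwards [eventually_ge_atTop 1] with N hN
  have h1 := h hT g₁ g₂ hg₁ hg₂ N hN
  rw [Real.norm_of_nonneg (wwAverage_nonneg _ _ _)]
  exact h1.trans (mul_le_mul_of_nonneg_left (le_abs_self _) hC.le)

/-- The Wiener-Wintner averages of a nonzero function decay at most like `N^{-1/3}`. -/
theorem ae_eq_zero_of_mem_PolyDecayWith (hT : MeasurePreserving T μ μ) (k : ℕ) (f : Lp ℂ ⊤ μ)
    {α : ℝ} (hα : 1 / 3 < α) (h : (fun N => wwAverage μ T (k + 1) N f) ∈ PolyDecayWith α) :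
    f =ᵐ[μ] fun _ => 0 := by
  have hR0 : 0 < 1 + ‖f‖ := by positivity
  obtain ⟨g, hg, e⟩ := exists_unitMeas_ae_eq f hR0 (by linarith)
  have hg' := wwAverage_mem_PolyDecayWith_of_ae_eq hT k hR0 e h
  set p := ∫ x, ‖g x‖ ^ 2 ∂μ with hp
  have hp0 : 0 ≤ p := integral_nonneg fun x => sq_nonneg _
  rcases hp0.eq_or_lt with h0 | h0
  · have := (integral_eq_zero_iff_of_nonneg (fun x => sq_nonneg _)
      (hg.bddMeas.integrable_norm_sq (μ := μ))).1 (hp.symm.trans h0.symm)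
    filter_upwards [this, e] with x h1 h2
    have : g x = 0 := by simpa using h1
    rw [h2, this, mul_zero]
  · exfalso
    -- With `δ = p/2` the averages are at least `c (p/2) N^{-1/3}`, which eventually exceeds `C
    -- N^{-α}`.
    obtain ⟨c, N₀, hc, hlow⟩ := exists_le_wwAverage k (p / 2) (by positivity)
    obtain ⟨C, hC⟩ := IsBigO.bound hg'
    have ht : Tendsto (fun N : ℕ => (N : ℝ) ^ (α - 1 / 3)) atTop atTop :=
      (tendsto_rpow_atTop (by linarith)).comp tendsto_natCast_atTop_atTop
    have hcp : 0 < c * (p / 2) := by positivity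
    obtain ⟨N, hN1, hN2, hN3, hN4⟩ := (hC.and ((ht.eventually_gt_atTop (C / (c * (p / 2)))).and
      ((eventually_ge_atTop N₀).and (eventually_ge_atTop 1)))).exists
    have hN' : (0 : ℝ) < N := by exact_mod_cast hN4
    have h1 := hlow hT g hg N hN3
    rw [Real.norm_of_nonneg (wwAverage_nonneg _ _ _), Real.norm_of_nonneg (by positivity)] at hN1
    have h2 := h1.trans hN1
    rw [div_lt_iff₀ hcp] at hN2
    have e3 : (N : ℝ) ^ (-(1 / 3) : ℝ) = (N : ℝ) ^ (α - 1 / 3) * (N : ℝ) ^ (-α) := by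
      rw [← Real.rpow_add hN']; congr 1; ring
    have h4 : 0 < (N : ℝ) ^ (-α) := by positivity
    rw [← hp, e3] at h2
    have h5 := mul_lt_mul_of_pos_right hN2 h4
    nlinarith

end PolynomialDecay

/-! ### The relation `≾` and comparison with zero -/

section Precsim

/-- Parameters for a relation `f ≾ g` with scale `φ N = max 2 ⌊N^{1/4}⌋`. -/
theorem exists_precsimData {α γ C : ℝ} (hα : 0 < α) (hα1 : α ≤ 1) (hγ : 0 < γ) (hγ1 : γ ≤ 1)
    (hC : 0 < C) : ∃ D : PrecsimData, D.α = α ∧ D.γ = γ ∧ D.C = C ∧ 16 ≤ D.N₀ ∧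
      ∀ N, 16 ≤ N → D.φ N = ⌊(N : ℝ) ^ (1 / 4 : ℝ)⌋₊ := by
  -- The growth condition must hold for every `N`. The exponent `1/8` leaves room for the floor once
  -- `N^{1/8} > 2`; the value `2` covers smaller `N`. From `N = 16` on the maximum is inactive.
  refine ⟨⟨α, 1 / 8, γ, C, 16, fun N => max 2 ⌊(N : ℝ) ^ (1 / 4 : ℝ)⌋₊, hα, hα1, by norm_num,
    by norm_num, hγ, hγ1, hC, fun a b hab => ?_, fun N => ?_⟩, rfl, rfl, rfl, le_rfl,
    fun N hN => ?_⟩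
  · refine max_le_max le_rfl (Nat.floor_mono (Real.rpow_le_rpow (Nat.cast_nonneg _) ?_ (by norm_num)))
    exact_mod_cast hab
  · have h0 : 0 ≤ (N : ℝ) ^ (1 / 8 : ℝ) := by positivity
    have e : (N : ℝ) ^ (1 / 4 : ℝ) = (N : ℝ) ^ (1 / 8 : ℝ) * (N : ℝ) ^ (1 / 8 : ℝ) := by
      rw [← sq, ← Real.rpow_natCast, ← Real.rpow_mul (Nat.cast_nonneg _)]; norm_num
    have h1 := Nat.lt_floor_add_one ((N : ℝ) ^ (1 / 4 : ℝ))
    push_cast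
    by_cases h : (N : ℝ) ^ (1 / 8 : ℝ) ≤ 2
    · exact h.trans (le_max_left _ _)
    · exact le_max_of_le_right (by nlinarith)
  · refine max_eq_right (Nat.le_floor ?_)
    have h16 : (16 : ℝ) ≤ N := by exact_mod_cast hN
    calc ((2 : ℕ) : ℝ) = (16 : ℝ) ^ (1 / 4 : ℝ) := by
          rw [show (16 : ℝ) = 2 ^ (4 : ℝ) by norm_num, ← Real.rpow_mul (by norm_num)]; norm_num
      _ ≤ _ := Real.rpow_le_rpow (by norm_num) h16 (by norm_num)

theorem mem_PolyDecay_iff_precsimEquiv_zero {r : ℕ → ℝ} (hr : ∀ N, 0 ≤ r N) :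
    r ∈ PolyDecay ↔ PrecsimEquiv r (fun _ => 0) := by
  constructor
  · rintro ⟨α, hα, h⟩
    -- The parameters of `≾` require an exponent at most `1`, so the rate is capped.
    have hm0 : 0 < min α 1 := lt_min hα one_pos
    obtain ⟨C, hC, hb⟩ := (PolyDecayWith_anti (min_le_left α 1) h).exists_pos
    obtain ⟨N₀, hN₀⟩ := Filter.eventually_atTop.1 hb.bound
    refine ⟨⟨⟨min α 1, 1, 1, C, N₀, id, hm0, min_le_right _ _, one_pos, le_rfl, one_pos, le_rfl, hC,
      monotone_id, fun N => by simp⟩, fun N hN => ?_⟩, ?_⟩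
    · have h1 := hN₀ N (le_of_lt hN)
      rw [Real.norm_of_nonneg (hr N), Real.norm_of_nonneg (by positivity),
        Real.rpow_neg (Nat.cast_nonneg _)] at h1
      simpa using h1
    · refine ⟨⟨1, 1, 1, 1, 0, id, one_pos, le_rfl, one_pos, le_rfl, one_pos, le_rfl, one_pos,
        monotone_id, fun N => by simp⟩, fun N _ => ?_⟩
      have := hr N
      simp only [id, Real.rpow_one]
      positivity
  · rintro ⟨⟨D, hD⟩, -⟩
    refine ⟨D.α, D.α_pos, Asymptotics.IsBigO.of_bound D.C ?_⟩
    filter_upwards [Filter.eventually_gt_atTop D.N₀] with N hN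
    have h1 := hD N hN
    rw [Real.zero_rpow D.γ_pos.ne', add_zero, one_div, ← Real.rpow_neg (Nat.cast_nonneg _)] at h1
    rwa [Real.norm_of_nonneg (hr N), Real.norm_of_nonneg (by positivity)]

end Precsim

/-! ### The estimates for classes in `L^∞` and their consequences -/

theorem exists_wwAverage_Lp_add_le (k : ℕ) : ∃ C : ℝ, 0 < C ∧
    ∀ {X : Type*} [MeasurableSpace X] {μ : Measure X} [IsProbabilityMeasure μ] {T : X → X},
      MeasurePreserving T μ μ → ∀ f₁ f₂ : Lp ℂ ⊤ μ, ‖f₁‖ ≤ 1 → ‖f₂‖ ≤ 1 → ∀ N : ℕ, 1 ≤ N →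
        wwAverage μ T (k + 1) N (f₁ + f₂ : Lp ℂ ⊤ μ) ≤
          C * (1 / (N : ℝ) ^ (1 / (3 * 2 ^ (k + 1 + 3)) : ℝ)
            + wwAverage μ T (k + 1) ⌊(N : ℝ) ^ (1 / 4 : ℝ)⌋₊ f₁ ^ (1 / (3 * 2 ^ (k + 1)) : ℝ)
            + wwAverage μ T (k + 1) ⌊(N : ℝ) ^ (1 / 4 : ℝ)⌋₊ f₂ ^ (1 / (3 * 2 ^ (k + 1)) : ℝ)) := by
  obtain ⟨C, hC, h⟩ := exists_wwAverage_add_le k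
  refine ⟨C, hC, fun {X} _ {μ} _ {T} hT f₁ f₂ hf₁ hf₂ N hN => ?_⟩
  have hp : (1 : ℝ) ≤ 2 ^ k := one_le_pow₀ one_le_two
  have hN1 : (1 : ℝ) ≤ N := by exact_mod_cast hN
  obtain ⟨g₁, hg₁, e₁⟩ := exists_unitMeas_ae_eq f₁ one_pos hf₁
  obtain ⟨g₂, hg₂, e₂⟩ := exists_unitMeas_ae_eq f₂ one_pos hf₂
  simp only [Complex.ofReal_one, one_mul] at e₁ e₂
  have e : (f₁ + f₂ : Lp ℂ ⊤ μ) =ᵐ[μ] fun x => g₁ x + g₂ x := by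
    filter_upwards [Lp.coeFn_add f₁ f₂, e₁, e₂] with x h h1 h2
    rw [h, Pi.add_apply, h1, h2]
  rw [wwAverage_congr_ae hT _ _ e, wwAverage_congr_ae hT _ _ e₁, wwAverage_congr_ae hT _ _ e₂]
  refine (h hT g₁ g₂ hg₁ hg₂ N hN).trans (mul_le_mul_of_nonneg_left ?_ hC.le)
  have hexp : (1 / (3 * 2 ^ (k + 1)) : ℝ) ≤ 1 / 6 := by
    refine one_div_le_one_div_of_le (by norm_num) ?_
    rw [pow_succ]; linarith
  -- The averages lie in `[0, 1]`, so lowering the exponent from `1/6` only increases the bound.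
  have hW : ∀ g : X → ℂ, UnitMeas g → wwAverage μ T (k + 1) ⌊(N : ℝ) ^ (1 / 4 : ℝ)⌋₊ g ^ (1 / 6 : ℝ) ≤
      wwAverage μ T (k + 1) ⌊(N : ℝ) ^ (1 / 4 : ℝ)⌋₊ g ^ (1 / (3 * 2 ^ (k + 1)) : ℝ) := fun g hg =>
    Real.rpow_le_rpow_of_exponent_ge' (wwAverage_nonneg _ _ _)
      (wwAverage_le_one hT.measurable _ _ hg) (by positivity) hexp
  refine add_le_add (add_le_add ?_ (hW g₁ hg₁)) (hW g₂ hg₂)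
  rw [one_div ((N : ℝ) ^ _), ← Real.rpow_neg (Nat.cast_nonneg _)]
  refine Real.rpow_le_rpow_of_exponent_le hN1 (neg_le_neg ?_)
  refine one_div_le_one_div_of_le (by norm_num) ?_
  rw [pow_add, pow_add]; linarith

theorem exists_precsimWith_wwAverage_add (k : ℕ) : ∃ D : PrecsimData,
    ∀ {X : Type*} [MeasurableSpace X] {μ : Measure X} [IsProbabilityMeasure μ] {T : X → X},
      MeasurePreserving T μ μ → ∀ f₁ f₂ : Lp ℂ ⊤ μ, ‖f₁‖ ≤ 1 → ‖f₂‖ ≤ 1 →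
        PrecsimWith D (fun N => wwAverage μ T (k + 1) N (f₁ + f₂ : Lp ℂ ⊤ μ))
          (fun N => wwAverage μ T (k + 1) N f₁ + wwAverage μ T (k + 1) N f₂) := by
  obtain ⟨C, hC, h⟩ := exists_wwAverage_Lp_add_le k
  have hp : ∀ n : ℕ, (1 / (3 * 2 ^ n) : ℝ) ≤ 1 := fun n => by
    have : (1 : ℝ) ≤ 2 ^ n := one_le_pow₀ one_le_two
    rw [div_le_one (by positivity)]
    linarith
  -- The factor `2` comes from `a^γ + b^γ ≤ 2 (a + b)^γ`.
  obtain ⟨D, hα, hγ, hDC, hN₀, hφ⟩ := exists_precsimData (α := 1 / (3 * 2 ^ (k + 1 + 3)))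
    (γ := 1 / (3 * 2 ^ (k + 1))) (C := 2 * C) (by positivity) (hp _) (by positivity) (hp _)
    (by positivity)
  refine ⟨D, fun {X} _ {μ} _ {T} hT f₁ f₂ hf₁ hf₂ N hN => ?_⟩
  refine (h hT f₁ f₂ hf₁ hf₂ N (by omega)).trans ?_
  rw [hα, hγ, hDC, hφ N (by omega)]
  set a := wwAverage μ T (k + 1) ⌊(N : ℝ) ^ (1 / 4 : ℝ)⌋₊ f₁
  set b := wwAverage μ T (k + 1) ⌊(N : ℝ) ^ (1 / 4 : ℝ)⌋₊ f₂
  have ha : 0 ≤ a := wwAverage_nonneg _ _ _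
  have hb : 0 ≤ b := wwAverage_nonneg _ _ _
  have h1 : a ^ (1 / (3 * 2 ^ (k + 1)) : ℝ) ≤ (a + b) ^ (1 / (3 * 2 ^ (k + 1)) : ℝ) :=
    Real.rpow_le_rpow ha (by linarith) (by positivity)
  have h2 : b ^ (1 / (3 * 2 ^ (k + 1)) : ℝ) ≤ (a + b) ^ (1 / (3 * 2 ^ (k + 1)) : ℝ) :=
    Real.rpow_le_rpow hb (by linarith) (by positivity)
  have h3 : 0 ≤ 1 / (N : ℝ) ^ (1 / (3 * 2 ^ (k + 1 + 3)) : ℝ) := by positivity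
  rw [mul_comm 2 C, mul_assoc]
  exact mul_le_mul_of_nonneg_left (by linarith) hC.le

theorem wwAverage_add_mem_PolyDecay {X : Type*} [MeasurableSpace X] {μ : Measure X}
    [IsProbabilityMeasure μ] {T : X → X} (hT : MeasurePreserving T μ μ) (k : ℕ)
    {f₁ f₂ : Lp ℂ ⊤ μ} (h₁ : (fun N => wwAverage μ T (k + 1) N f₁) ∈ PolyDecay)
    (h₂ : (fun N => wwAverage μ T (k + 1) N f₂) ∈ PolyDecay) :
    (fun N => wwAverage μ T (k + 1) N (f₁ + f₂ : Lp ℂ ⊤ μ)) ∈ PolyDecay := by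
  obtain ⟨α, hα, h₁⟩ := h₁
  obtain ⟨β, hβ, h₂⟩ := h₂
  have hm : 0 < min (min α β) (1 / 2) := lt_min (lt_min hα hβ) (by norm_num)
  refine ⟨min (min α β) (1 / 2) / 24, by positivity, ?_⟩
  exact wwAverage_add_mem_PolyDecayWith hT k f₁ f₂ hm.le (min_le_right _ _)
    (PolyDecayWith_anti ((min_le_left _ _).trans (min_le_left _ _)) h₁)
    (PolyDecayWith_anti ((min_le_left _ _).trans (min_le_right _ _)) h₂)

theorem wwAverage_add_mem_PolyDecayWith_min {X : Type*} [MeasurableSpace X] {μ : Measure X}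
    [IsProbabilityMeasure μ] {T : X → X} (hT : MeasurePreserving T μ μ) (k : ℕ)
    {f₁ f₂ : Lp ℂ ⊤ μ} {α β : ℝ} (hα : 0 < α) (hβ : 0 < β)
    (h₁ : (fun N => wwAverage μ T (k + 1) N f₁) ∈ PolyDecayWith α)
    (h₂ : (fun N => wwAverage μ T (k + 1) N f₂) ∈ PolyDecayWith β) :
    (fun N => wwAverage μ T (k + 1) N (f₁ + f₂ : Lp ℂ ⊤ μ)) ∈
      PolyDecayWith (min α β / (3 * 2 ^ (k + 1 + 2))) := by
  have hm : 0 < min α β := lt_min hα hβ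
  by_cases hle : min α β ≤ 1 / 2
  · refine PolyDecayWith_anti ?_ (wwAverage_add_mem_PolyDecayWith hT k f₁ f₂ hm.le hle
      (PolyDecayWith_anti (min_le_left _ _) h₁) (PolyDecayWith_anti (min_le_right _ _) h₂))
    refine div_le_div_of_nonneg_left hm.le (by norm_num) ?_
    have : (1 : ℝ) ≤ 2 ^ k := one_le_pow₀ one_le_two
    rw [pow_add, pow_add]
    linarith
  -- Both rates exceed `1/2 > 1/3`, so both functions, and hence their sum, vanish almost
  -- everywhere.
  · rw [not_le, lt_min_iff] at hle
    have z₁ := ae_eq_zero_of_mem_PolyDecayWith hT k f₁ (by linarith) h₁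
    have z₂ := ae_eq_zero_of_mem_PolyDecayWith hT k f₂ (by linarith) h₂
    have z : (f₁ + f₂ : Lp ℂ ⊤ μ) =ᵐ[μ] fun _ => 0 := by
      filter_upwards [Lp.coeFn_add f₁ f₂, z₁, z₂] with x h h1 h2
      rw [h, Pi.add_apply, h1, h2, add_zero]
    simp only [wwAverage_ae_zero hT k _ z]
    exact Asymptotics.isBigO_zero _ _

/-- The functions whose Wiener-Wintner averages are of power type. -/
def powerTypeSubmodule {X : Type*} [MeasurableSpace X] {μ : Measure X} [IsProbabilityMeasure μ]
    {T : X → X} (hT : MeasurePreserving T μ μ) (k : ℕ) : Submodule ℂ (Lp ℂ ⊤ μ) where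
  carrier := {f | (fun N => wwAverage μ T (k + 1) N f) ∈ PolyDecay}
  add_mem' h₁ h₂ := wwAverage_add_mem_PolyDecay hT k h₁ h₂
  zero_mem' := by
    refine ⟨1, one_pos, ?_⟩
    have z : ((0 : Lp ℂ ⊤ μ) : X → ℂ) =ᵐ[μ] fun _ => 0 := Lp.coeFn_zero ℂ ⊤ μ
    simp only [wwAverage_ae_zero hT k _ z]
    exact Asymptotics.isBigO_zero _ _
  smul_mem' c f hf := by
    obtain ⟨α, hα, h⟩ := hf
    refine ⟨α, hα, ?_⟩
    have z : ((c • f : Lp ℂ ⊤ μ) : X → ℂ) =ᵐ[μ] fun x => c * f x := Lp.coeFn_smul c f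
    simp only [wwAverage_congr_ae hT (k + 1) _ z, wwAverage_const_mul]
    exact const_mul_mem_PolyDecayWith h

theorem theoremT (k : ℕ) (hk : 1 ≤ k) :
    -- the basic estimate, with constants that depend on `k` only
    (∃ (C : ℝ) (N₀ : ℕ), 0 < C ∧
      ∀ (X : Type*) [MeasurableSpace X] (μ : Measure X) [IsProbabilityMeasure μ]
        (T : X ≃ᵐ X), MeasurePreserving T μ μ →
        ∀ f₁ f₂ : Lp ℂ ⊤ μ, ‖f₁‖ ≤ 1 → ‖f₂‖ ≤ 1 → ∀ N : ℕ, N₀ ≤ N →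
          wwAverage μ T k N (f₁ + f₂ : Lp ℂ ⊤ μ) ≤
            C * (1 / (N : ℝ) ^ (1 / (3 * 2 ^ (k + 3)) : ℝ)
              + wwAverage μ T k ⌊(N : ℝ) ^ (1 / 4 : ℝ)⌋₊ f₁ ^ (1 / (3 * 2 ^ k) : ℝ)
              + wwAverage μ T k ⌊(N : ℝ) ^ (1 / 4 : ℝ)⌋₊ f₂ ^ (1 / (3 * 2 ^ k) : ℝ))) ∧
    -- its asymptotic form, with parameters that depend on `k` only
    (∃ D : PrecsimData,
      ∀ (X : Type*) [MeasurableSpace X] (μ : Measure X) [IsProbabilityMeasure μ]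
        (T : X ≃ᵐ X), MeasurePreserving T μ μ →
        ∀ f₁ f₂ : Lp ℂ ⊤ μ, ‖f₁‖ ≤ 1 → ‖f₂‖ ≤ 1 →
          PrecsimWith D (fun N => wwAverage μ T k N (f₁ + f₂ : Lp ℂ ⊤ μ))
            (fun N => wwAverage μ T k N f₁ + wwAverage μ T k N f₂)) ∧
    -- the consequences for functions of power type
    (∀ (X : Type*) [MeasurableSpace X] (μ : Measure X) [IsProbabilityMeasure μ]
        (T : X ≃ᵐ X), MeasurePreserving T μ μ →
      (∀ f₁ f₂ : Lp ℂ ⊤ μ,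
        (fun N => wwAverage μ T k N f₁) ∈ PolyDecay →
        (fun N => wwAverage μ T k N f₂) ∈ PolyDecay →
        (fun N => wwAverage μ T k N (f₁ + f₂ : Lp ℂ ⊤ μ)) ∈ PolyDecay) ∧
      {f : Lp ℂ ⊤ μ | (fun N => wwAverage μ T k N f) ∈ PolyDecay} =
        {f : Lp ℂ ⊤ μ | PrecsimEquiv (fun N => wwAverage μ T k N f) (fun _ => 0)} ∧
      (∃ V : Submodule ℂ (Lp ℂ ⊤ μ),
        (V : Set (Lp ℂ ⊤ μ)) = {f : Lp ℂ ⊤ μ | (fun N => wwAverage μ T k N f) ∈ PolyDecay}) ∧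
      (∀ (f₁ f₂ : Lp ℂ ⊤ μ) (α β : ℝ), 0 < α → 0 < β →
        (fun N => wwAverage μ T k N f₁) ∈ PolyDecayWith α →
        (fun N => wwAverage μ T k N f₂) ∈ PolyDecayWith β →
        (fun N => wwAverage μ T k N (f₁ + f₂ : Lp ℂ ⊤ μ)) ∈
          PolyDecayWith (min α β / (3 * 2 ^ (k + 2))))) := by
  obtain ⟨k, rfl⟩ := Nat.exists_eq_add_of_le' hk
  refine ⟨?_, ?_, fun X _ μ _ T hT => ⟨fun f₁ f₂ h₁ h₂ => wwAverage_add_mem_PolyDecay hT k h₁ h₂,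
    ?_, ⟨powerTypeSubmodule hT k, rfl⟩,
    fun f₁ f₂ α β hα hβ h₁ h₂ => wwAverage_add_mem_PolyDecayWith_min hT k hα hβ h₁ h₂⟩⟩
  · obtain ⟨C, hC, h⟩ := exists_wwAverage_Lp_add_le k
    exact ⟨C, 1, hC, fun X _ μ _ T hT f₁ f₂ h₁ h₂ N hN => h hT f₁ f₂ h₁ h₂ N hN⟩
  · obtain ⟨D, h⟩ := exists_precsimWith_wwAverage_add k
    exact ⟨D, fun X _ μ _ T hT f₁ f₂ h₁ h₂ => h hT f₁ f₂ h₁ h₂⟩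
  · ext f
    exact mem_PolyDecay_iff_precsimEquiv_zero fun N => wwAverage_nonneg _ _ _
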